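/- Let $K/F$ be a finite Galois extension of number fields with Galois group $G$, let $\overline{F}$ be an algebraic closure of $F$ containing $K$, and put $G_F=\mathrm{Gal}(\overline F/F)$, $G_K=\mathrm{Gal}(\overline F/K)$. For every place $v$ of $F$ fix a place $w$ of $K$ above $v$ and put $G_w=\mathrm{Gal}(K_w/F_v)$, where $F_v$, $K_w$ are the completions. Let $E/F$ be an elliptic curve. For a number field $L\in\{F,K\}$ let $$Ш(E/L)=\ker\Big(H^1(G_L,E(\overline F))\to\prod_{v}H^1\big(\mathrm{Gal}(\overline{L_v}/L_v),E(\overline{L_v})\big)\Big),$$ the product being over all places $v$ of $L$ (finite and infinite), and assume that $Ш(E/F)$ and $Ш(E/K)$ are finite. Let $\mathrm{Res}:H^1(G_F,E(\overline F))\to H^1(G_K,E(\overline F))^G$ be the restriction map, let $\widetilde{\mathrm{Res}}$ be its restriction to $Ш(E/F)$ (its image lies in $Ш(E/K)^G$), let $\mathrm{Trans}:H^1(G_K,E(\overline F))^G\to H^2(G,E(K))$ be the transgression map, and let $\mathrm{trans}:Ш(E/K)^G\to H^2(G,E(K))$ be its restriction to $Ш(E/K)^G$; one has $\mathrm{Im}(\widetilde{\mathrm{Res}})\subseteq\ker(\mathrm{trans})$.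 Suppose that there is an exact sequence of abelian groups $$0\to\ker(\widetilde{\mathrm{Res}})\to H^1(G,E(K))\xrightarrow{\ \mathcal F\ }\bigoplus_v H^1(G_w,E(K_w))\to\frac{\ker(\mathrm{trans})}{\mathrm{Im}(\widetilde{\mathrm{Res}})}\to 0,$$ where $v$ runs over all places of $F$ and $\mathcal F$ is the localization map. Then $H^1(G,E(K))$ and all the groups $H^1(G_w,E(K_w))$ are finite, $H^1(G_w,E(K_w))=0$ for all but finitely many $v$, and $$\frac{\#\ker(\mathrm{trans})}{\#Ш(E/F)}=\frac{\prod_v\#H^1(G_w,E(K_w))}{\#H^1(G,E(K))}.$$ Moreover, $\mathrm{trans}$ is the zero map if and only if $$\frac{\#\big(Ш(E/K)^G\big)}{\#Ш(E/F)}=\frac{\prod_v\#H^1(G_w,E(K_w))}{\#H^1(G,E(K))}.$$ -/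

import Mathlib

open NumberField IsDedekindDomain

/-! ### Cohomology of (profinite) groups in degrees one and two -/

section Cohomology

/-- Continuous 1-cocycles `f (g h) = g • f h + f g` of a topological group `Γ` with values in a
discrete `Γ`-module `M`. Continuity for the discrete topology on `M` is local constancy. -/
def contCocycles₁ (Γ M : Type*) [Group Γ] [TopologicalSpace Γ] [AddCommGroup M]
    [DistribMulAction Γ M] : AddSubgroup (Γ → M) where
  carrier := {f | IsLocallyConstant f ∧ groupCohomology.IsCocycle₁ f}
  zero_mem' := ⟨IsLocallyConstant.const 0, fun g h ↦ by simp⟩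
  add_mem' := by
    rintro f f' ⟨hf, hf1⟩ ⟨hf', hf1'⟩
    refine ⟨hf.add hf', fun g h ↦ ?_⟩
    simp only [Pi.add_apply, hf1 g h, hf1' g h, smul_add]
    abel
  neg_mem' := by
    rintro f ⟨hf, hf1⟩
    refine ⟨hf.neg, fun g h ↦ ?_⟩
    simp only [Pi.neg_apply, hf1 g h, smul_neg]
    abel

/-- The 1-coboundaries `g ↦ g • m - m`, as a subgroup of the continuous 1-cocycles. -/
def contCoboundaries₁ (Γ M : Type*) [Group Γ] [TopologicalSpace Γ] [AddCommGroup M]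
    [DistribMulAction Γ M] : AddSubgroup (contCocycles₁ Γ M) where
  carrier := {f | groupCohomology.IsCoboundary₁ (f : Γ → M)}
  zero_mem' := ⟨0, fun g ↦ by simp⟩
  add_mem' := by
    rintro f f' ⟨m, hm⟩ ⟨m', hm'⟩
    refine ⟨m + m', fun g ↦ ?_⟩
    simp only [AddSubgroup.coe_add, Pi.add_apply, ← hm g, ← hm' g, smul_add]
    abel
  neg_mem' := by
    rintro f ⟨m, hm⟩
    refine ⟨-m, fun g ↦ ?_⟩
    simp only [AddSubgroup.coe_neg, Pi.neg_apply, ← hm g, smul_neg]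
    abel

/-- Continuous cohomology `H¹(Γ, M)` with coefficients in a discrete module. For a discrete group
(for instance a finite Galois group with its Krull topology) this is ordinary group cohomology. -/
abbrev H1 (Γ M : Type*) [Group Γ] [TopologicalSpace Γ] [AddCommGroup M] [DistribMulAction Γ M] :
    Type _ :=
  contCocycles₁ Γ M ⧸ contCoboundaries₁ Γ M

/-- Functoriality of `H¹` for a compatible pair `φ : Γ' → Γ`, `ψ : M → M'`, that is
`ψ (φ g • m) = g • ψ m`: the class of `f` goes to the class of `ψ ∘ f ∘ φ`. -/
def H1.map {Γ Γ' M M' : Type*} [Group Γ] [TopologicalSpace Γ] [AddCommGroup M]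
    [DistribMulAction Γ M] [Group Γ'] [TopologicalSpace Γ'] [AddCommGroup M']
    [DistribMulAction Γ' M'] (φ : Γ' →* Γ) (hφ : Continuous φ) (ψ : M →+ M')
    (h : ∀ g m, ψ (φ g • m) = g • ψ m) : H1 Γ M →+ H1 Γ' M' :=
  QuotientAddGroup.map _ _
    { toFun := fun f ↦ ⟨fun g ↦ ψ (f.1 (φ g)),
        (f.2.1.comp_continuous hφ).comp ψ, fun g g' ↦ by
          simp [f.2.2 (φ g) (φ g'), h]⟩
      map_zero' := by ext; simp
      map_add' := fun f f' ↦ by ext; simp }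
    (by
      rintro f ⟨m, hm⟩
      exact ⟨ψ m, fun g ↦ by simp [← hm (φ g), h]⟩)

/-- 2-cocycles of a (discrete) group. -/
def discreteCocycles₂ (G A : Type*) [Group G] [AddCommGroup A] [DistribMulAction G A] :
    AddSubgroup (G × G → A) where
  carrier := {c | groupCohomology.IsCocycle₂ c}
  zero_mem' := fun g h j ↦ by simp
  add_mem' := by
    intro c c' hc hc' g h j
    have := congrArg₂ (· + ·) (hc g h j) (hc' g h j)
    simp only [Pi.add_apply, smul_add] at this ⊢
    rw [add_add_add_comm, this]
    abel
  neg_mem' := by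
    intro c hc g h j
    have := congrArg (- ·) (hc g h j)
    simpa only [Pi.neg_apply, smul_neg, neg_add] using this

/-- 2-coboundaries of a (discrete) group. -/
def discreteCoboundaries₂ (G A : Type*) [Group G] [AddCommGroup A] [DistribMulAction G A] :
    AddSubgroup (discreteCocycles₂ G A) where
  carrier := {c | groupCohomology.IsCoboundary₂ (c : G × G → A)}
  zero_mem' := ⟨0, fun g h ↦ by simp⟩
  add_mem' := by
    rintro c c' ⟨x, hx⟩ ⟨x', hx'⟩
    refine ⟨x + x', fun g h ↦ ?_⟩
    simp only [AddSubgroup.coe_add, Pi.add_apply, ← hx g h, ← hx' g h, smul_add]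
    abel
  neg_mem' := by
    rintro c ⟨x, hx⟩
    refine ⟨-x, fun g h ↦ ?_⟩
    simp only [AddSubgroup.coe_neg, Pi.neg_apply, ← hx g h, smul_neg]
    abel

/-- `H²(G, A)` for a (finite, discrete) group `G`. -/
abbrev H2 (G A : Type*) [Group G] [AddCommGroup A] [DistribMulAction G A] : Type _ :=
  discreteCocycles₂ G A ⧸ discreteCoboundaries₂ G A

end Cohomology

/-! ### The transgression, on cochains -/

section Transgression

variable {Γ N G M A : Type*} [Group Γ] [Group N] [Group G] [AddCommGroup M] [AddCommGroup A]
  [DistribMulAction Γ M]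

/-- Let `1 → N → Γ → G → 1` be an extension (with maps `j`, `π`), `M` a `Γ`-module and
`i : A → M` the inclusion of `M ^ N`. The 2-cochain `c` of `G` with values in `A` is a transgression
of `f : N → M` if `f` extends to a 1-cochain `y` of `Γ` whose coboundary is inflated from `c`. -/
def IsTransgression (j : N →* Γ) (π : Γ →* G) (i : A →+ M) (f : N → M) (c : G × G → A) : Prop :=
  ∃ y : Γ → M, (∀ n, y (j n) = f n) ∧
    ∀ a b, i (c (π a, π b)) = a • y b - y (a * b) + y a

variable {j : N →* Γ} {π : Γ →* G} {i : A →+ M}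

theorem IsTransgression.add {f f' : N → M} {c c' : G × G → A} (h : IsTransgression j π i f c)
    (h' : IsTransgression j π i f' c') : IsTransgression j π i (f + f') (c + c') := by
  obtain ⟨y, hy, hc⟩ := h
  obtain ⟨y', hy', hc'⟩ := h'
  refine ⟨y + y', fun n ↦ by simp [hy, hy'], fun a b ↦ ?_⟩
  simp only [Pi.add_apply, map_add, hc, hc', smul_add]
  abel

theorem IsTransgression.neg {f : N → M} {c : G × G → A} (h : IsTransgression j π i f c) :
    IsTransgression j π i (-f) (-c) := by
  obtain ⟨y, hy, hc⟩ := h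
  refine ⟨-y, fun n ↦ by simp [hy], fun a b ↦ ?_⟩
  simp only [Pi.neg_apply, map_neg, hc, smul_neg]
  abel

theorem IsTransgression.isCocycle₂ [DistribMulAction G A] (hπ : Function.Surjective π) (hi : Function.Injective i)
    (hiπ : ∀ g a, i (π g • a) = g • i a) {f : N → M} {c : G × G → A}
    (h : IsTransgression j π i f c) : groupCohomology.IsCocycle₂ c := by
  obtain ⟨y, -, hc⟩ := h
  intro g h k
  obtain ⟨g, rfl⟩ := hπ g
  obtain ⟨h, rfl⟩ := hπ h
  obtain ⟨k, rfl⟩ := hπ k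
  apply hi
  rw [map_add, map_add, hiπ, ← map_mul, ← map_mul, hc, hc, hc, hc]
  simp only [smul_add, smul_sub, mul_smul, mul_assoc]
  abel

theorem IsTransgression.isCoboundary₂ [DistribMulAction N M] [DistribMulAction G A]
    (hπ : Function.Surjective π) (hi : Function.Injective i)
    (hiπ : ∀ g a, i (π g • a) = g • i a) (hj : π.ker = j.range)
    (hN : ∀ (n : N) (m : M), n • m = j n • m)
    (hA : ∀ m : M, (∀ n : N, n • m = m) → m ∈ i.range) {f : N → M} {c : G × G → A}
    (hf : groupCohomology.IsCoboundary₁ f) (h : IsTransgression j π i f c) : groupCohomology.IsCoboundary₂ c := by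
  obtain ⟨y, hy, hc⟩ := h
  obtain ⟨m, hm⟩ := hf
  have hπj : ∀ n, π (j n) = 1 := fun n ↦ by
    have : j n ∈ π.ker := hj ▸ ⟨n, rfl⟩
    exact this
  set z : Γ → M := fun g ↦ y g - (g • m - m) with hz
  have hc' : ∀ a b, i (c (π a, π b)) = a • z b - z (a * b) + z a := by
    intro a b
    rw [hc]
    simp only [hz, smul_sub, mul_smul]
    abel
  have hzj : ∀ n, z (j n) = 0 := fun n ↦ by simp [hz, hy, ← hm, hN]
  have hz1 : z 1 = 0 := by simpa using hzj 1
  have hr : ∀ g n, z (g * j n) = z g := by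
    intro g n
    have h1 := hc' g (j n)
    have h2 := hc' g 1
    rw [hzj, smul_zero, hπj] at h1
    rw [hz1, smul_zero, mul_one, map_one] at h2
    rw [h1] at h2
    simpa [neg_add_eq_zero] using h2
  have hl : ∀ n g, z (j n * g) = j n • z g := by
    intro n g
    have h1 := hc' (j n) g
    have h2 := hc' 1 g
    rw [hzj, hπj] at h1
    rw [hz1, one_smul, one_mul, map_one] at h2
    rw [h1] at h2
    simp only [add_zero, sub_self, sub_eq_zero] at h2
    exact h2.symm
  have hcoset : ∀ g g', π g = π g' → z g = z g' := by
    intro g g' hgg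
    have : g⁻¹ * g' ∈ j.range := hj ▸ (by simp [MonoidHom.mem_ker, hgg])
    obtain ⟨n, hn⟩ := this
    have := hr g n
    rw [hn, mul_inv_cancel_left] at this
    exact this.symm
  have hinv : ∀ g, z g ∈ i.range := by
    intro g
    refine hA _ fun n ↦ ?_
    rw [hN, ← hl]
    exact hcoset _ _ (by rw [map_mul, hπj, one_mul])
  choose s hs using hπ
  choose x hx using fun g ↦ hinv (s g)
  refine ⟨x, fun g h ↦ hi ?_⟩
  rw [map_add, map_sub, hx, hx]
  have h1 : i (g • x h) = s g • z (s h) := by rw [← hx, ← hiπ, hs]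
  have h2 : z (s (g * h)) = z (s g * s h) := hcoset _ _ (by simp [hs])
  rw [h1, h2, ← hc', hs, hs]

theorem IsTransgression.exists [DistribMulAction N M] (hπ : Function.Surjective π)
    (hjinj : Function.Injective j) (hj : π.ker = j.range)
    (hN : ∀ (n : N) (m : M), n • m = j n • m)
    (hA : ∀ m : M, (∀ n : N, n • m = m) → m ∈ i.range) {f : N → M} (hf : groupCohomology.IsCocycle₁ f)
    (hinv : ∀ σ : Γ, ∃ m : M, ∀ n n', j n' = σ⁻¹ * j n * σ → n • m - m = σ • f n' - f n) :
    ∃ c : G × G → A, IsTransgression j π i f c := by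
  have hπj : ∀ n, π (j n) = 1 := fun n ↦ by
    have : j n ∈ π.ker := hj ▸ ⟨n, rfl⟩
    exact this
  have hker : ∀ g, π g = 1 → ∃ n, j n = g := fun g hg ↦ by
    have : g ∈ j.range := hj ▸ (MonoidHom.mem_ker.2 hg)
    exact this
  have hf1 : f 1 = 0 := by simpa using groupCohomology.map_one_of_isCocycle₁ hf
  obtain ⟨s, hs, hs1⟩ : ∃ s : G → Γ, (∀ g, π (s g) = g) ∧ s 1 = 1 := by
    classical
    choose s hs using hπ
    refine ⟨Function.update s 1 1, fun g ↦ ?_, by simp⟩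
    by_cases hg : g = 1
    · subst hg; simp
    · simp [hg, hs]
  obtain ⟨m, hm, hm1⟩ : ∃ m : G → M, (∀ g n n', j n' = (s g)⁻¹ * j n * s g →
      n • m g - m g = s g • f n' - f n) ∧ m 1 = 0 := by
    classical
    choose m hm using fun g ↦ hinv (s g)
    refine ⟨Function.update m 1 0, fun g n n' hn ↦ ?_, by simp⟩
    by_cases hg : g = 1
    · subst hg
      rw [hs1, inv_one, one_mul, mul_one] at hn
      simp [hjinj hn, hs1]
    · simpa [hg] using hm g n n' hn
  choose ν hν using fun g : Γ ↦ hker (g * (s (π g))⁻¹) (by simp [hs])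
  have hdec : ∀ g, j (ν g) * s (π g) = g := fun g ↦ by simp [hν]
  set y : Γ → M := fun g ↦ f (ν g) + ν g • m (π g) with hy
  have hνl : ∀ n g, ν (j n * g) = n * ν g := fun n g ↦ hjinj (by simp [hν, hπj, mul_assoc])
  have hyl : ∀ n g, y (j n * g) = f n + j n • y g := by
    intro n g
    simp only [hy, hνl, hf n (ν g), map_mul, hπj, one_mul, smul_add, mul_smul, hN]
    abel
  have hyj : ∀ n, y (j n) = f n := by
    intro n
    have hν1 : ν 1 = 1 := hjinj (by simp [hν, hs1])
    have := hyl n 1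
    simpa [hy, hν1, hf1, hm1] using this
  have hys : ∀ g, y (s g) = m g := by
    intro g
    have : ν (s g) = 1 := hjinj (by simp [hν, hs])
    simp [hy, this, hf1, hs]
  have hysr : ∀ g n, y (s g * j n) = y (s g) + s g • f n := by
    intro g n
    obtain ⟨n', hn'⟩ := hker (s g * j n * (s g)⁻¹) (by simp [hπj])
    have h1 : s g * j n = j n' * s g := by simp [hn']
    have h2 := hm g n' n (by simp [hn', mul_assoc])
    rw [h1, hyl, hys, ← hN, eq_comm, ← sub_eq_zero]
    rw [sub_eq_sub_iff_add_eq_add] at h2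
    rw [sub_eq_zero, add_comm (f n'), h2]
    abel
  have hyr : ∀ g n, y (g * j n) = y g + g • f n := by
    intro g n
    have h1 : g * j n = j (ν g) * (s (π g) * j n) := by rw [← mul_assoc, hdec]
    have h2 : y g = f (ν g) + j (ν g) • y (s (π g)) := by rw [← hyl, hdec]
    rw [h1, hyl, hysr, h2, smul_add, ← mul_smul, hdec]
    abel
  set d : Γ → Γ → M := fun a b ↦ a • y b - y (a * b) + y a with hd
  have hdl : ∀ n a b, d (j n * a) b = j n • d a b := by
    intro n a b
    simp only [hd, mul_assoc, hyl, mul_smul, smul_add, smul_sub]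
    abel
  have hdr : ∀ n a b, d a (b * j n) = d a b := by
    intro n a b
    simp only [hd, hyr, ← mul_assoc, mul_smul, smul_add]
    abel
  have hdm : ∀ n a b, d (a * j n) b = d a (j n * b) := by
    intro n a b
    simp only [hd, hyr, hyl, mul_assoc, mul_smul, smul_add]
    abel
  have hconj : ∀ b b', π b = π b' → ∃ n, b' = b * j n := by
    intro b b' hbb
    obtain ⟨n, hn⟩ := hker (b⁻¹ * b') (by simp [hbb])
    exact ⟨n, by simp [hn]⟩
  have hd2 : ∀ a b b', π b = π b' → d a b = d a b' := by
    intro a b b' hbb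
    obtain ⟨n, rfl⟩ := hconj b b' hbb
    rw [hdr]
  have hd1 : ∀ a a' b, π a = π a' → d a b = d a' b := by
    intro a a' b haa
    obtain ⟨n, rfl⟩ := hconj a a' haa
    rw [hdm]
    exact hd2 _ _ _ (by simp [hπj])
  have hdA : ∀ a b, d a b ∈ i.range := by
    intro a b
    refine hA _ fun n ↦ ?_
    rw [hN, ← hdl]
    exact hd1 _ _ _ (by simp [hπj])
  choose c hc using fun p : G × G ↦ hdA (s p.1) (s p.2)
  refine ⟨c, y, hyj, fun a b ↦ ?_⟩
  rw [hc]
  exact (hd1 _ a _ (hs _)).trans (hd2 a _ b (hs _))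

end Transgression

/-! ### Galois groups acting on points of an elliptic curve -/

section Points

variable {R : Type*} [CommRing R] (W : WeierstrassCurve R)

/-- The group `E(L)` of `L`-rational points (including the point at infinity) of the Weierstrass
curve `W` over `R`, where `L` is a field which is an `R`-algebra. -/
def Pts (L : Type*) [Field L] [Algebra R L] : Type _ := (W.baseChange L).toAffine.Point

open scoped Classical in
noncomputable instance (L : Type*) [Field L] [Algebra R L] : AddCommGroup (Pts W L) :=
  inferInstanceAs (AddCommGroup (W.baseChange L).toAffine.Point)

variable {S L L' L'' : Type*} [CommRing S] [Field L] [Field L'] [Field L''] [Algebra R S]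
  [Algebra R L] [Algebra S L] [IsScalarTower R S L] [Algebra R L'] [Algebra S L']
  [IsScalarTower R S L'] [Algebra R L''] [Algebra S L''] [IsScalarTower R S L'']

open scoped Classical in
/-- The homomorphism `E(L) → E(L')` induced by an embedding of fields `L → L'`. -/
noncomputable def Pts.map (f : L →ₐ[S] L') : Pts W L →+ Pts W L' :=
  WeierstrassCurve.Affine.Point.map (W' := W.toAffine) f

theorem Pts.map_map (f : L →ₐ[S] L') (g : L' →ₐ[S] L'') (P : Pts W L) :
    Pts.map W g (Pts.map W f P) = Pts.map W (g.comp f) P := by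
  classical
  exact WeierstrassCurve.Affine.Point.map_map (W' := W.toAffine) f g P

theorem Pts.map_injective (f : L →ₐ[S] L') : Function.Injective (Pts.map W f) := by
  classical
  exact WeierstrassCurve.Affine.Point.map_injective (W' := W.toAffine) f

theorem Pts.map_congr {S' : Type*} [CommRing S'] [Algebra R S'] [Algebra S' L]
    [IsScalarTower R S' L] [Algebra S' L'] [IsScalarTower R S' L'] {f : L →ₐ[S] L'}
    {g : L →ₐ[S'] L'} (h : ∀ x, f x = g x) (P : Pts W L) : Pts.map W f P = Pts.map W g P := by
  match P with
  | .zero => rfl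
  | .some x y _ =>
    change WeierstrassCurve.Affine.Point.some (f x) (f y) _ = .some (g x) (g y) _
    simp only [h]

/-- `Gal(L/S)` acts on `E(L)` through its action on coordinates. -/
noncomputable instance : DistribMulAction (L ≃ₐ[S] L) (Pts W L) where
  smul σ P := Pts.map W (σ : L →ₐ[S] L) P
  one_smul P := by
    match P with
    | .zero => rfl
    | .some _ _ _ => rfl
  mul_smul σ τ P := by
    match P with
    | .zero => rfl
    | .some _ _ _ => rfl
  smul_zero σ := map_zero _
  smul_add σ := map_add _

theorem Pts.smul_def (σ : L ≃ₐ[S] L) (P : Pts W L) : σ • P = Pts.map W (σ : L →ₐ[S] L) P := rfl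

end Points

section Restriction

variable {F L Ω Λ : Type*} [Field F] [Field L] [Field Ω] [Field Λ] [Algebra F L] [Algebra F Ω]
  [Algebra F Λ] [Algebra L Λ] [IsScalarTower F L Λ]

/-- For a tower `Λ / L / F`, a normal extension `Ω / F` and an `F`-embedding `ι : Ω → Λ`, the
restriction homomorphism `Gal(Λ/L) → Gal(Ω/F)`, `σ ↦ σ|_Ω`, characterised by
`ι (σ|_Ω x) = σ (ι x)`. -/
noncomputable def galRes [Normal F Ω] (ι : Ω →ₐ[F] Λ) : (Λ ≃ₐ[L] Λ) →* (Ω ≃ₐ[F] Ω) :=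
  letI : Algebra Ω Λ := ι.toRingHom.toAlgebra
  haveI : IsScalarTower F Ω Λ := .of_algebraMap_eq fun x ↦ (ι.commutes x).symm
  (AlgEquiv.restrictNormalHom (F := F) (K₁ := Λ) Ω).comp
    { toFun := fun σ ↦ σ.restrictScalars F, map_one' := rfl, map_mul' := fun _ _ ↦ rfl }

theorem galRes_apply [Normal F Ω] (ι : Ω →ₐ[F] Λ) (σ : Λ ≃ₐ[L] Λ) (x : Ω) :
    ι (galRes ι σ x) = σ (ι x) := by
  let : Algebra Ω Λ := ι.toRingHom.toAlgebra
  have : IsScalarTower F Ω Λ := .of_algebraMap_eq fun x ↦ (ι.commutes x).symm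
  exact AlgEquiv.restrictNormal_commutes (σ.restrictScalars F) Ω x

theorem continuous_gal_of_nhds {Γ : Type*} [Group Γ] [TopologicalSpace Γ] [IsTopologicalGroup Γ]
    (φ : Γ →* (Ω ≃ₐ[F] Ω)) (h : ∀ x : Ω, {g | φ g x = x} ∈ nhds (1 : Γ)) : Continuous φ := by
  refine continuous_of_continuousAt_one φ (continuousAt_def.2 fun s hs ↦ ?_)
  rw [map_one, krullTopology_mem_nhds_one_iff] at hs
  obtain ⟨E, hE, hEs⟩ := hs
  let b := Module.finBasis F E
  filter_upwards [Filter.eventually_all.2 fun k ↦ h (b k)] with g hg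
  refine hEs ?_
  rw [SetLike.mem_coe, IntermediateField.mem_fixingSubgroup_iff]
  intro x hx
  have := b.ext (f₁ := (φ g).toLinearMap.comp E.val.toLinearMap) (f₂ := E.val.toLinearMap) hg
  exact congrArg (fun f ↦ f ⟨x, hx⟩) this

theorem mem_nhds_one_of_isIntegral {y : Λ} (hy : IsIntegral L y) :
    {σ : Λ ≃ₐ[L] Λ | σ y = y} ∈ nhds (1 : Λ ≃ₐ[L] Λ) := by
  rw [krullTopology_mem_nhds_one_iff]
  refine ⟨IntermediateField.adjoin L {y}, IntermediateField.adjoin.finiteDimensional hy,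
    fun σ hσ ↦ ?_⟩
  rw [SetLike.mem_coe, IntermediateField.mem_fixingSubgroup_iff] at hσ
  exact hσ y (IntermediateField.mem_adjoin_simple_self L y)

theorem continuous_galRes [Normal F Ω] (ι : Ω →ₐ[F] Λ) :
    Continuous (galRes (L := L) ι) := by
  refine continuous_gal_of_nhds _ fun x ↦ ?_
  have hx : IsIntegral L (ι x) := ((Normal.isIntegral ‹_› x).map ι).tower_top
  filter_upwards [mem_nhds_one_of_isIntegral hx] with σ hσ
  exact ι.injective ((galRes_apply ι σ x).trans hσ)

variable {R : Type*} [CommRing R] (W : WeierstrassCurve R) [Algebra R F] [Algebra R L]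
  [Algebra R Ω] [Algebra R Λ] [IsScalarTower R F Ω] [IsScalarTower R F Λ] [IsScalarTower R L Λ]

theorem Pts.map_galRes_smul [Normal F Ω] (ι : Ω →ₐ[F] Λ) (σ : Λ ≃ₐ[L] Λ) (P : Pts W Ω) :
    Pts.map W ι (galRes ι σ • P) = σ • Pts.map W ι P := by
  match P with
  | .zero => rfl
  | .some x y _ =>
    change WeierstrassCurve.Affine.Point.some (ι (galRes ι σ x)) (ι (galRes ι σ y)) _ =
      .some (σ (ι x)) (σ (ι y)) _
    simp only [galRes_apply]

/-- The map `H¹(Gal(Ω/F), E(Ω)) → H¹(Gal(Λ/L), E(Λ))` induced by an `F`-embedding `ι : Ω → Λ`: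
the class of `f` goes to the class of `σ ↦ ι (f (σ|_Ω))`. Inflation, restriction and localization
maps are all of this form. -/
noncomputable def galMap [Normal F Ω] (ι : Ω →ₐ[F] Λ) :
    H1 (Ω ≃ₐ[F] Ω) (Pts W Ω) →+ H1 (Λ ≃ₐ[L] Λ) (Pts W Λ) :=
  H1.map (galRes ι) (continuous_galRes ι) (Pts.map W ι)
    (Pts.map_galRes_smul W ι)

end Restriction

/-! ### Places and completions of number fields -/

/-- The places of a number field `L`: the finite ones (maximal ideals of the ring of integers) and
the infinite ones. -/
abbrev Place (L : Type*) [Field L] : Type _ := HeightOneSpectrum (𝓞 L) ⊕ InfinitePlace L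

namespace Place
variable {F K L : Type*} [Field F] [NumberField F] [Field K] [NumberField K] [Field L]
  [NumberField L] [Algebra F K] [Algebra F L]

/-- The completion `L_v` of `L` at the place `v`. -/
def Completion : Place L → Type _
  | .inl v => v.adicCompletion L
  | .inr v => v.Completion

noncomputable instance : (v : Place L) → Field v.Completion
  | .inl v => inferInstanceAs (Field (v.adicCompletion L))
  | .inr v => inferInstanceAs (Field v.Completion)

/-- For an extension `L / F`, the field `L_v` is an `F`-algebra (in particular for `F = L`). -/
noncomputable instance : (v : Place L) → Algebra F v.Completion
  | .inl v => inferInstanceAs (Algebra F (v.adicCompletion L))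
  | .inr v => inferInstanceAs (Algebra F v.Completion)

instance : (v : Place L) → IsScalarTower F L v.Completion
  | .inl v => inferInstanceAs (IsScalarTower F L (v.adicCompletion L))
  | .inr _ => .of_algebraMap_eq fun _ ↦ rfl

/-- The place `w` of `K` lies above the place `v` of `F`. -/
class LiesOver (w : Place K) (v : Place F) : Prop where
  out : match w, v with
    | .inl w, .inl v => w.asIdeal.LiesOver v.asIdeal
    | .inr w, .inr v => w.1.LiesOver v.1
    | _, _ => False

/-- The embedding `F_v → K_w` for finite places, the continuous extension of `F → K`. -/
noncomputable def adicMap (v : HeightOneSpectrum (𝓞 F)) (w : HeightOneSpectrum (𝓞 K))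
    [w.asIdeal.LiesOver v.asIdeal] : v.adicCompletion F →+* w.adicCompletion K :=
  (((HeightOneSpectrum.adicCompletion.equiv K w).symm : _ →+* _).comp
    (UniformSpace.Completion.mapRingHom
      (algebraMap (WithVal (v.valuation F)) (WithVal (w.valuation K)))
      (HeightOneSpectrum.uniformContinuous_algebraMap_liesOver F K v w).continuous)).comp
    (HeightOneSpectrum.adicCompletion.equiv F v : _ →+* _)

theorem adicMap_algebraMap (v : HeightOneSpectrum (𝓞 F)) (w : HeightOneSpectrum (𝓞 K))
    [w.asIdeal.LiesOver v.asIdeal] (x : F) :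
    adicMap v w (algebraMap F (v.adicCompletion F) x) = algebraMap F (w.adicCompletion K) x := by
  apply HeightOneSpectrum.adicCompletion.ext
  refine (UniformSpace.Completion.extensionHom_coe _ _ _).trans ?_
  rfl

/-- The embedding `F_v → K_w` for a place `w` of `K` above `v`, the continuous extension of
`F → K`. -/
noncomputable def completionMap : (w : Place K) → (v : Place F) → w.LiesOver v →
    (v.Completion →+* w.Completion)
  | .inl w, .inl v, h => haveI := h.out; adicMap v w
  | .inr w, .inr v, h => haveI : w.1.LiesOver v.1 := h.out; NumberField.LiesOver.completionMap (v := v) (w := w)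
  | .inl _, .inr _, h => h.out.elim
  | .inr _, .inl _, h => h.out.elim

theorem completionMap_algebraMap (x : F) : (w : Place K) → (v : Place F) → (h : w.LiesOver v) →
    completionMap w v h (algebraMap F v.Completion x) = algebraMap F w.Completion x
  | .inl w, .inl v, h => haveI := h.out; adicMap_algebraMap v w x
  | .inr w, .inr v, h => by
    have : w.1.LiesOver v.1 := h.out
    open NumberField.LiesOver in
    exact (IsScalarTower.algebraMap_apply F v.Completion w.Completion x).symm
  | .inl _, .inr _, h => h.out.elim
  | .inr _, .inl _, h => h.out.elim

noncomputable instance (w : Place K) (v : Place F) [h : w.LiesOver v] :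
    Algebra v.Completion w.Completion := (completionMap w v h).toAlgebra

instance (w : Place K) (v : Place F) [h : w.LiesOver v] :
    IsScalarTower F v.Completion w.Completion :=
  .of_algebraMap_eq fun x ↦ (completionMap_algebraMap x w v h).symm
end Place

/-! ### Global cohomology: restriction, the Galois action, and the transgression -/

section Global

variable {F : Type*} [Field F] (W : WeierstrassCurve F) (K Ω : Type*) [Field K] [Field Ω]
  [Algebra F K] [Algebra F Ω] [Algebra K Ω] [IsScalarTower F K Ω]

/-- The inclusion `E(K) → E(Ω)`. -/
noncomputable abbrev ptsIncl : Pts W K →+ Pts W Ω := Pts.map W (IsScalarTower.toAlgHom F K Ω)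

/-- The projection `Gal(Ω/F) → Gal(K/F)`. -/
noncomputable abbrev galProj [Normal F K] : (Ω ≃ₐ[F] Ω) →* (K ≃ₐ[F] K) :=
  galRes (IsScalarTower.toAlgHom F K Ω)

variable (F) in
/-- The inclusion `Gal(Ω/K) → Gal(Ω/F)`. -/
noncomputable abbrev galIncl [Normal F Ω] : (Ω ≃ₐ[K] Ω) →* (Ω ≃ₐ[F] Ω) :=
  galRes (AlgHom.id F Ω)

variable {K Ω}

theorem galIncl_apply [Normal F Ω] (n : Ω ≃ₐ[K] Ω) (x : Ω) : galIncl F K Ω n x = n x :=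
  galRes_apply (AlgHom.id F Ω) n x

/-- Conjugation `n ↦ σ⁻¹ n σ` of `Gal(Ω/K)` by an element `σ` of `Gal(Ω/F)`, for `K / F` normal. -/
noncomputable def galConj [Normal F K] (σ : Ω ≃ₐ[F] Ω) : (Ω ≃ₐ[K] Ω) →* (Ω ≃ₐ[K] Ω) where
  toFun n := AlgEquiv.ofRingEquiv
    (f := ((σ.toRingEquiv.trans n.toRingEquiv).trans σ.symm.toRingEquiv)) fun k ↦ by
      have h : algebraMap K Ω (galProj K Ω σ k) = σ (algebraMap K Ω k) :=
        galRes_apply (IsScalarTower.toAlgHom F K Ω) σ k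
      change σ.symm (n (σ (algebraMap K Ω k))) = algebraMap K Ω k
      rw [← h, n.commutes, h, σ.symm_apply_apply]
  map_one' := by
    ext x
    exact σ.symm_apply_apply x
  map_mul' n n' := by
    ext x
    change σ.symm (n (n' (σ x))) = σ.symm (n (σ (σ.symm (n' (σ x)))))
    rw [σ.apply_symm_apply]

theorem galConj_apply [Normal F K] (σ : Ω ≃ₐ[F] Ω) (n : Ω ≃ₐ[K] Ω) (x : Ω) :
    galConj σ n x = σ.symm (n (σ x)) := rfl

theorem continuous_galConj [Normal F K] [Algebra.IsAlgebraic K Ω] (σ : Ω ≃ₐ[F] Ω) :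
    Continuous (galConj (K := K) σ) := by
  refine continuous_gal_of_nhds _ fun x ↦ ?_
  filter_upwards [mem_nhds_one_of_isIntegral
    (Algebra.IsAlgebraic.isAlgebraic (R := K) (σ x)).isIntegral] with n hn
  change σ.symm (n (σ x)) = x
  rw [show n (σ x) = σ x from hn, σ.symm_apply_apply]

theorem smul_galConj_smul [Normal F K] (σ : Ω ≃ₐ[F] Ω) (n : Ω ≃ₐ[K] Ω) (P : Pts W Ω) :
    σ • (galConj σ n • P) = n • (σ • P) := by
  match P with
  | .zero => rfl
  | .some x y _ =>
    change WeierstrassCurve.Affine.Point.some (σ (σ.symm (n (σ x)))) (σ (σ.symm (n (σ y)))) _ =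
      .some (n (σ x)) (n (σ y)) _
    simp only [σ.apply_symm_apply]

/-- The action of `σ ∈ Gal(Ω/F)` on `H¹(Gal(Ω/K), E(Ω))`: the class of `f` goes to the class of
`n ↦ σ • f (σ⁻¹ n σ)`. The subgroup `Gal(Ω/K)` acts trivially; this is the action of `Gal(K/F)`. -/
noncomputable def galAct [Normal F K] [Algebra.IsAlgebraic K Ω] (σ : Ω ≃ₐ[F] Ω) :
    H1 (Ω ≃ₐ[K] Ω) (Pts W Ω) →+ H1 (Ω ≃ₐ[K] Ω) (Pts W Ω) :=
  H1.map (galConj σ) (continuous_galConj σ) (DistribSMul.toAddMonoidHom _ σ)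
    fun n P ↦ smul_galConj_smul W σ n P

variable (K Ω)

/-- The invariants `H¹(Gal(Ω/K), E(Ω)) ^ Gal(K/F)`. -/
noncomputable def H1inv [Normal F K] [Algebra.IsAlgebraic K Ω] :
    AddSubgroup (H1 (Ω ≃ₐ[K] Ω) (Pts W Ω)) :=
  ⨅ σ : Ω ≃ₐ[F] Ω, (galAct W σ).eqLocus (AddMonoidHom.id _)

variable {K Ω}

theorem mem_H1inv [Normal F K] [Algebra.IsAlgebraic K Ω] {x : H1 (Ω ≃ₐ[K] Ω) (Pts W Ω)} :
    x ∈ H1inv W K Ω ↔ ∀ σ : Ω ≃ₐ[F] Ω, galAct W σ x = x := by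
  simp only [H1inv, AddSubgroup.mem_iInf]
  rfl

theorem galIncl_smul [Normal F Ω] (n : Ω ≃ₐ[K] Ω) (P : Pts W Ω) :
    n • P = galIncl F K Ω n • P := by
  match P with
  | .zero => rfl
  | .some x y _ =>
    change WeierstrassCurve.Affine.Point.some (n x) (n y) _ =
      .some (galIncl F K Ω n x) (galIncl F K Ω n y) _
    simp only [galIncl_apply]

theorem galIncl_galConj [Normal F K] [Normal F Ω] (σ : Ω ≃ₐ[F] Ω) (n : Ω ≃ₐ[K] Ω) :
    galIncl F K Ω (galConj σ n) = σ⁻¹ * galIncl F K Ω n * σ := by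
  ext x
  rw [galIncl_apply, galConj_apply]
  change _ = σ.symm (galIncl F K Ω n (σ x))
  rw [galIncl_apply]

theorem galMap_mem_H1inv [Normal F K] [Normal F Ω] [Algebra.IsAlgebraic K Ω]
    (x : H1 (Ω ≃ₐ[F] Ω) (Pts W Ω)) :
    galMap (L := K) W (AlgHom.id F Ω) x ∈ H1inv W K Ω := by
  rw [mem_H1inv]
  intro σ
  induction x using QuotientAddGroup.induction_on with | H f =>
  refine (QuotientAddGroup.eq_iff_sub_mem).2 ⟨f.1 σ, fun n ↦ ?_⟩
  have hid : ∀ P : Pts W Ω, Pts.map W (AlgHom.id F Ω) P = P := fun P ↦ by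
    match P with
    | .zero => rfl
    | .some _ _ _ => rfl
  change n • f.1 σ - f.1 σ = σ • Pts.map W (AlgHom.id F Ω) (f.1 (galIncl F K Ω (galConj σ n))) -
    Pts.map W (AlgHom.id F Ω) (f.1 (galIncl F K Ω n))
  have h1 : f.1 1 = 0 := groupCohomology.map_one_of_isCocycle₁ f.2.2
  have h2 := f.2.2 σ σ⁻¹
  rw [mul_inv_cancel, h1] at h2
  rw [hid, hid, galIncl_galConj, f.2.2, f.2.2, galIncl_smul W n, smul_add, smul_add,
    eq_neg_of_add_eq_zero_left h2.symm, ← mul_smul, ← mul_smul]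
  simp only [mul_smul, smul_inv_smul]
  abel

variable (K Ω)

/-- The restriction map `Res : H¹(Gal(Ω/F), E(Ω)) → H¹(Gal(Ω/K), E(Ω)) ^ Gal(K/F)`. -/
noncomputable def resMap [Normal F K] [Normal F Ω] [Algebra.IsAlgebraic K Ω] :
    H1 (Ω ≃ₐ[F] Ω) (Pts W Ω) →+ H1inv W K Ω :=
  (galMap (L := K) W (AlgHom.id F Ω)).codRestrict _ (galMap_mem_H1inv W)

variable [Normal F K] [IsGalois F Ω]

theorem galProj_surjective : Function.Surjective (galProj K Ω : (Ω ≃ₐ[F] Ω) →* (K ≃ₐ[F] K)) := by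
  intro τ
  obtain ⟨σ, hσ⟩ := AlgEquiv.restrictNormalHom_surjective (F := F) (K₁ := K) Ω τ
  refine ⟨σ, AlgEquiv.ext fun x ↦ (algebraMap K Ω).injective ?_⟩
  rw [← hσ]
  exact (galRes_apply (IsScalarTower.toAlgHom F K Ω) σ x).trans
    (AlgEquiv.restrictNormal_commutes σ K x).symm

theorem galProj_ker : (galProj K Ω : (Ω ≃ₐ[F] Ω) →* (K ≃ₐ[F] K)).ker = (galIncl F K Ω).range := by
  ext σ
  have h : ∀ k, algebraMap K Ω (galProj K Ω σ k) = σ (algebraMap K Ω k) :=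
    galRes_apply (IsScalarTower.toAlgHom F K Ω) σ
  constructor
  · intro hσ
    refine ⟨AlgEquiv.ofRingEquiv (f := σ.toRingEquiv) fun k ↦ ?_, ?_⟩
    · change σ (algebraMap K Ω k) = _
      rw [← h, MonoidHom.mem_ker.1 hσ]
      rfl
    · ext x
      rw [galIncl_apply]
      rfl
  · rintro ⟨n, rfl⟩
    refine MonoidHom.mem_ker.2 (AlgEquiv.ext fun k ↦ (algebraMap K Ω).injective ?_)
    rw [h, galIncl_apply, n.commutes]
    rfl

theorem galIncl_injective : Function.Injective (galIncl F K Ω) := by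
  intro n n' h
  ext x
  rw [← galIncl_apply (F := F), h, galIncl_apply]

theorem ptsIncl_smul (σ : Ω ≃ₐ[F] Ω) (P : Pts W K) :
    ptsIncl W K Ω (galProj K Ω σ • P) = σ • ptsIncl W K Ω P :=
  Pts.map_galRes_smul W (IsScalarTower.toAlgHom F K Ω) σ P

theorem mem_range_ptsIncl (P : Pts W Ω) (hP : ∀ n : Ω ≃ₐ[K] Ω, n • P = P) :
    P ∈ (ptsIncl W K Ω).range := by
  have : IsGalois K Ω := IsGalois.tower_top_of_isGalois F K Ω
  match P with
  | .zero => exact ⟨0, map_zero _⟩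
  | .some x y hxy =>
    have hn : ∀ n : Ω ≃ₐ[K] Ω, n x = x ∧ n y = y := fun n ↦
      WeierstrassCurve.Affine.Point.some.inj (hP n)
    obtain ⟨x, rfl⟩ := (InfiniteGalois.mem_range_algebraMap_iff_fixed x).2 fun n ↦ (hn n).1
    obtain ⟨y, rfl⟩ := (InfiniteGalois.mem_range_algebraMap_iff_fixed y).2 fun n ↦ (hn n).2
    exact ⟨.some x y ((W.toAffine.baseChange_nonsingular
      (IsScalarTower.toAlgHom F K Ω).injective x y).1 hxy), rfl⟩

variable {K Ω}

/-- `z ∈ H²(Gal(K/F), E(K))` is a transgression of `x ∈ H¹(Gal(Ω/K), E(Ω))`. -/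
def IsTransgressionClass (x : H1 (Ω ≃ₐ[K] Ω) (Pts W Ω)) (z : H2 (K ≃ₐ[F] K) (Pts W K)) : Prop :=
  ∃ (f : contCocycles₁ (Ω ≃ₐ[K] Ω) (Pts W Ω)) (c : discreteCocycles₂ (K ≃ₐ[F] K) (Pts W K)),
    (f : H1 (Ω ≃ₐ[K] Ω) (Pts W Ω)) = x ∧ (c : H2 (K ≃ₐ[F] K) (Pts W K)) = z ∧
    IsTransgression (galIncl F K Ω) (galProj K Ω) (ptsIncl W K Ω) (f : (Ω ≃ₐ[K] Ω) → Pts W Ω)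
      (c : (K ≃ₐ[F] K) × (K ≃ₐ[F] K) → Pts W K)

theorem IsTransgressionClass.add {x x' : H1 (Ω ≃ₐ[K] Ω) (Pts W Ω)}
    {z z' : H2 (K ≃ₐ[F] K) (Pts W K)} (h : IsTransgressionClass W x z)
    (h' : IsTransgressionClass W x' z') : IsTransgressionClass W (x + x') (z + z') := by
  obtain ⟨f, c, rfl, rfl, h⟩ := h
  obtain ⟨f', c', rfl, rfl, h'⟩ := h'
  exact ⟨f + f', c + c', rfl, rfl, h.add h'⟩

theorem IsTransgressionClass.unique {x : H1 (Ω ≃ₐ[K] Ω) (Pts W Ω)}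
    {z z' : H2 (K ≃ₐ[F] K) (Pts W K)} (h : IsTransgressionClass W x z)
    (h' : IsTransgressionClass W x z') : z = z' := by
  obtain ⟨f, c, hx, rfl, h⟩ := h
  obtain ⟨f', c', rfl, rfl, h'⟩ := h'
  rw [QuotientAddGroup.eq_iff_sub_mem] at hx ⊢
  have h2 := h.add h'.neg
  rw [← sub_eq_add_neg, ← sub_eq_add_neg] at h2
  exact h2.isCoboundary₂ (galProj_surjective K Ω) (Pts.map_injective W _) (ptsIncl_smul W K Ω)
    (galProj_ker K Ω) (galIncl_smul W) (mem_range_ptsIncl W K Ω) hx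

theorem IsTransgressionClass.exists [Algebra.IsAlgebraic K Ω] (x : H1 (Ω ≃ₐ[K] Ω) (Pts W Ω))
    (hx : x ∈ H1inv W K Ω) : ∃ z, IsTransgressionClass W x z := by
  rw [mem_H1inv] at hx
  induction x using QuotientAddGroup.induction_on with | H f =>
  obtain ⟨c, hc⟩ := IsTransgression.exists (i := ptsIncl W K Ω) (galProj_surjective K Ω)
    (galIncl_injective K Ω) (galProj_ker K Ω) (galIncl_smul W) (mem_range_ptsIncl W K Ω) f.2.2
    fun σ ↦ by
      obtain ⟨m, hm⟩ := QuotientAddGroup.eq_iff_sub_mem.1 (hx σ)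
      refine ⟨m, fun n n' hn ↦ ?_⟩
      rw [← galIncl_galConj] at hn
      rw [galIncl_injective K Ω hn]
      exact hm n
  exact ⟨_, f, ⟨c, hc.isCocycle₂ (galProj_surjective K Ω) (Pts.map_injective W _)
    (ptsIncl_smul W K Ω)⟩, rfl, rfl, hc⟩

variable (K Ω)

/-- The transgression `Trans : H¹(Gal(Ω/K), E(Ω)) ^ Gal(K/F) → H²(Gal(K/F), E(K))`: it sends the
class of `f` to the class of the 2-cocycle from which the coboundary of a suitable extension of `f`
to `Gal(Ω/F)` is inflated. -/
noncomputable def transMap [Algebra.IsAlgebraic K Ω] :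
    H1inv W K Ω →+ H2 (K ≃ₐ[F] K) (Pts W K) :=
  AddMonoidHom.mk' (fun x ↦ (IsTransgressionClass.exists W x.1 x.2).choose) fun x x' ↦
    (IsTransgressionClass.exists W _ (x + x').2).choose_spec.unique W
      ((IsTransgressionClass.exists W x.1 x.2).choose_spec.add W
        (IsTransgressionClass.exists W x'.1 x'.2).choose_spec)

theorem transMap_spec [Algebra.IsAlgebraic K Ω] (x : H1inv W K Ω) :
    IsTransgressionClass W (x : H1 (Ω ≃ₐ[K] Ω) (Pts W Ω)) (transMap W K Ω x) :=
  (IsTransgressionClass.exists W x.1 x.2).choose_spec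

end Global

/-! ### Tate-Shafarevich groups and the exact sequence -/

section Sha

variable {F : Type*} [Field F] [NumberField F] (W : WeierstrassCurve F)

/-- The Tate-Shafarevich group `Ш(E/L)` of the elliptic curve `E` over `F` given by `W`, for a
number field `L / F` with algebraic closure `Ω`: the classes in `H¹(G_L, E(Ω))` which become trivial
in `H¹(G_{L_v}, E(L_v^al))` for every place `v` of `L`. The localization map at `v` is formed with
an `L`-embedding `ι` of `Ω` into the algebraic closure of `L_v`; its kernel does not depend on
`ι`, as any two embeddings differ by an element of `G_L`, which acts trivially on `H¹(G_L, E(Ω))`. -/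
noncomputable def Sha (L Ω : Type*) [Field L] [NumberField L] [Algebra F L] [Field Ω]
    [Algebra F Ω] [Algebra L Ω] [IsScalarTower F L Ω] [Normal L Ω] :
    AddSubgroup (H1 (Ω ≃ₐ[L] Ω) (Pts W Ω)) :=
  ⨅ (v : Place L) (ι : Ω →ₐ[L] AlgebraicClosure v.Completion),
    (galMap (L := v.Completion) W ι).ker

variable (K Ω : Type*) [Field K] [NumberField K] [Algebra F K] [IsGalois F K] [Field Ω]
  [Algebra F Ω] [Algebra K Ω] [IsScalarTower F K Ω] [IsGalois F Ω] [Normal K Ω]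

/-- `Ш(E/K) ^ G`, `G = Gal(K/F)`, as a subgroup of `H¹(G_K, E) ^ G`. -/
noncomputable def shaInv : AddSubgroup (H1inv W K Ω) := (Sha W K Ω).addSubgroupOf (H1inv W K Ω)

/-- `trans : Ш(E/K) ^ G → H²(G, E(K))`, the restriction of the transgression. -/
noncomputable def shaTrans : shaInv W K Ω →+ H2 (K ≃ₐ[F] K) (Pts W K) :=
  (transMap W K Ω).comp (shaInv W K Ω).subtype

/-- The restriction of `Res : H¹(G_F, E) → H¹(G_K, E) ^ G` to `Ш(E/F)`. -/
noncomputable def shaRes : Sha W F Ω →+ H1inv W K Ω := (resMap W K Ω).comp (Sha W F Ω).subtype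

/-- The quotient of `Ker(trans)` by the image of `Ш(E/F)` under restriction. (The image is contained
in `Ker(trans)`; formally it is pulled back to a subgroup of `Ker(trans)`.) -/
abbrev TransQuotient : Type _ :=
  (shaTrans W K Ω).ker ⧸
    ((shaRes W K Ω).range.addSubgroupOf (shaInv W K Ω)).addSubgroupOf (shaTrans W K Ω).ker

variable {K}

/-- `H¹(G_w, E(K_w))`, where `G_w = Gal(K_w/F_v)` for a place `w` of `K` above the place `v`. -/
abbrev LocalH1 (w : Place K) (v : Place F) [w.LiesOver v] : Type _ :=
  H1 (w.Completion ≃ₐ[v.Completion] w.Completion) (Pts W w.Completion)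

/-- The localization map `H¹(G, E(K)) → H¹(G_w, E(K_w))`. -/
noncomputable def localMap (w : Place K) (v : Place F) [w.LiesOver v] :
    H1 (K ≃ₐ[F] K) (Pts W K) →+ LocalH1 W w v :=
  galMap (L := v.Completion) W (IsScalarTower.toAlgHom F K w.Completion)

/-- Exactness of the sequence
`0 → Ker(Res|Ш(E/F)) → H¹(G, E(K)) → ⨁_v H¹(G_w, E(K_w)) → Ker(trans) / Res(Ш(E/F)) → 0`,
for a choice `w v` of a place of `K` above every place `v` of `F`. The middle map `β` is the
localization map; no condition but exactness is imposed on the two other homomorphisms `α`, `γ`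
(so this is implied by exactness with any particular choice of them). -/
def SequenceExact (w : Place F → Place K) [∀ v, (w v).LiesOver v] : Prop :=
  ∃ (α : (shaRes W K Ω).ker →+ H1 (K ≃ₐ[F] K) (Pts W K))
    (β : H1 (K ≃ₐ[F] K) (Pts W K) →+ DirectSum (Place F) fun v ↦ LocalH1 W (w v) v)
    (γ : (DirectSum (Place F) fun v ↦ LocalH1 W (w v) v) →+ TransQuotient W K Ω),
    (∀ x v, β x v = localMap W (w v) v x) ∧
    Function.Injective α ∧ Function.Exact α β ∧ Function.Exact β γ ∧ Function.Surjective γ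

end Sha

namespace WeierstrassCurve.Affine
variable {F : Type*} [Field F] [DecidableEq F] {W : Affine F}

/-- The duplication formula for the `x`-coordinate. -/
lemma addX_self_mul {x y : F} (h : W.Equation x y) (hy : y ≠ W.negY x y) :
    W.addX x x (W.slope x x y y) * (4 * x ^ 3 + W.b₂ * x ^ 2 + 2 * W.b₄ * x + W.b₆) =
      x ^ 4 - W.b₄ * x ^ 2 - 2 * W.b₆ * x - W.b₈ := by
  rw [equation_iff] at h
  have hη : y - W.negY x y ≠ 0 := sub_ne_zero.2 hy
  have hℓ : W.slope x x y y * (y - W.negY x y) = 3 * x ^ 2 + 2 * W.a₂ * x + W.a₄ - W.a₁ * y := by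
    rw [slope_of_Y_ne rfl hy, div_mul_cancel₀ _ hη]
  simp only [negY] at hℓ
  generalize W.slope x x y y = ℓ at *
  simp only [addX, b₂, b₄, b₆, b₈]
  grind

lemma addX_add_addX_negY {x₁ y₁ x₂ y₂ : F} (h₁ : W.Equation x₁ y₁) (h₂ : W.Equation x₂ y₂)
    (hx : x₁ ≠ x₂) :
    (W.addX x₁ x₂ (W.slope x₁ x₂ y₁ y₂) + W.addX x₁ x₂ (W.slope x₁ x₂ y₁ (W.negY x₂ y₂))) *
      (x₁ - x₂) ^ 2 = 2 * (x₁ + x₂) * (x₁ * x₂) + W.b₂ * (x₁ * x₂) + W.b₄ * (x₁ + x₂) + W.b₆ := by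
  rw [equation_iff] at h₁ h₂
  rw [slope_of_X_ne hx, slope_of_X_ne hx]
  have hη : x₁ - x₂ ≠ 0 := sub_ne_zero.2 hx
  simp only [addX, negY, b₂, b₄, b₆]
  field_simp
  grind

lemma addX_mul_addX_negY {x₁ y₁ x₂ y₂ : F} (h₁ : W.Equation x₁ y₁) (h₂ : W.Equation x₂ y₂)
    (hx : x₁ ≠ x₂) :
    (W.addX x₁ x₂ (W.slope x₁ x₂ y₁ y₂) * W.addX x₁ x₂ (W.slope x₁ x₂ y₁ (W.negY x₂ y₂))) *
      (x₁ - x₂) ^ 2 = (x₁ * x₂) ^ 2 - W.b₄ * (x₁ * x₂) - W.b₆ * (x₁ + x₂) - W.b₈ := by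
  rw [equation_iff] at h₁ h₂
  rw [slope_of_X_ne hx, slope_of_X_ne hx]
  have hη : x₁ - x₂ ≠ 0 := sub_ne_zero.2 hx
  simp only [addX, negY, b₄, b₆, b₈]
  field_simp
  grind

omit [DecidableEq F] in
lemma sq_sub_negY {x y : F} (h : W.Equation x y) :
    (y - W.negY x y) ^ 2 = 4 * x ^ 3 + W.b₂ * x ^ 2 + 2 * W.b₄ * x + W.b₆ := by
  rw [equation_iff] at h
  simp only [negY, b₂, b₄, b₆]
  linear_combination 4 * h

namespace Point

omit [DecidableEq F] in
lemma eval_addSubMap (W : WeierstrassCurve F) (a b c : F) :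
    (fun i ↦ (addSubMap W i).eval ![a, b, c]) =
      ![a ^ 2 - W.b₄ * a * c - W.b₆ * b * c - W.b₈ * c ^ 2,
        2 * b * a + W.b₂ * a * c + W.b₄ * b * c + W.b₆ * c ^ 2, b ^ 2 - 4 * a * c] := by
  ext i
  fin_cases i <;> simp [addSubMap]

lemma exists_eval_addSubMap_self (P : W.Point) :
    ∃ t : F, (fun i ↦ (addSubMap W i).eval (P.sym2x P)) = t • (P + P).sym2x 0 := by
  match P with
  | 0 => exact ⟨1, by simp [eval_addSubMap]⟩
  | some x y h =>
    rw [sym2x_some_some, eval_addSubMap]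
    by_cases hy : y = W.negY x y
    · rw [add_self_of_Y_eq hy, sym2x_zero_zero]
      have h0 := sq_sub_negY h.1
      rw [sub_eq_zero.2 hy] at h0
      refine ⟨(x * x) ^ 2 - W.b₄ * (x * x) - W.b₆ * (x + x) - W.b₈, ?_⟩
      ext i
      fin_cases i
      · simp
      · simp
        linear_combination -h0
      · simp
        ring
    · rw [add_self_of_Y_ne hy, sym2x_some_zero]
      refine ⟨4 * x ^ 3 + W.b₂ * x ^ 2 + 2 * W.b₄ * x + W.b₆, ?_⟩
      have := addX_self_mul h.1 hy
      generalize W.addX x x (W.slope x x y y) = X at *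
      ext i
      fin_cases i
      · simp
        linear_combination -this
      · simp
        ring
      · simp
        ring

/-- The map `addSubMap` sends `(x(P) x(Q) : x(P) + x(Q) : 1)` to
`(x(P + Q) x(P - Q) : x(P + Q) + x(P - Q) : 1)`. -/
lemma exists_eval_addSubMap (P Q : W.Point) :
    ∃ t : F, (fun i ↦ (addSubMap W i).eval (P.sym2x Q)) = t • (P + Q).sym2x (P - Q) := by
  by_cases h1 : P = Q
  · subst h1
    simpa using exists_eval_addSubMap_self P
  by_cases h2 : P = -Q
  · subst h2
    obtain ⟨t, ht⟩ := exists_eval_addSubMap_self (-Q)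
    refine ⟨t, ?_⟩
    rw [sym2x_neg_right] at ht
    rw [ht, sym2x_comm, neg_add_cancel, sub_eq_add_neg]
  match P, Q with
  | 0, 0 => exact absurd rfl h1
  | 0, some x y h =>
    refine ⟨1, ?_⟩
    rw [zero_add, zero_sub, sym2x_neg_right, sym2x_zero_some, sym2x_some_some, eval_addSubMap]
    ext i
    fin_cases i <;> simp <;> ring
  | some x y h, 0 =>
    refine ⟨1, ?_⟩
    rw [add_zero, sub_zero, sym2x_some_zero, sym2x_some_some, eval_addSubMap]
    ext i
    fin_cases i <;> simp <;> ring
  | some x₁ y₁ h₁, some x₂ y₂ h₂ =>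
    have hx : x₁ ≠ x₂ := fun hx ↦ (X_eq_iff.1 hx).elim h1 h2
    refine ⟨(x₁ - x₂) ^ 2, ?_⟩
    have hs := addX_add_addX_negY h₁.1 h₂.1 hx
    have hp := addX_mul_addX_negY h₁.1 h₂.1 hx
    rw [sub_eq_add_neg (some x₁ y₁ h₁), neg_some, add_of_X_ne hx, add_of_X_ne hx,
      sym2x_some_some, sym2x_some_some, eval_addSubMap]
    generalize W.addX x₁ x₂ (W.slope x₁ x₂ y₁ y₂) = X at *
    generalize W.addX x₁ x₂ (W.slope x₁ x₂ y₁ (W.negY x₂ y₂)) = X' at *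
    ext i
    fin_cases i
    · simp
      linear_combination -hp
    · simp
      linear_combination -hs
    · simp
      ring

/-- The naive logarithmic height of a point, the height of its `x`-coordinate. -/
noncomputable def naiveHeight [Height.AdmissibleAbsValues F] (P : W.Point) : ℝ :=
  Height.logHeight P.xRep

open Height in
/-- The approximate parallelogram law. -/
lemma abs_naiveHeight_le [AdmissibleAbsValues F] [W.IsElliptic] :
    ∃ C, ∀ P Q : W.Point, |(P + Q).naiveHeight + (P - Q).naiveHeight -
      2 * (P.naiveHeight + Q.naiveHeight)| ≤ C := by
  obtain ⟨C₁, hC₁⟩ := abs_logHeight_addSubMap_sub_two_mul_logHeight_le W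
  obtain ⟨C₂, hC₂⟩ := abs_logHeight_sym2_sub_le F
  have hsym (P Q : W.Point) :
      |logHeight (P.sym2x Q) - (P.naiveHeight + Q.naiveHeight)| ≤ C₂ := by
    have hvec (P : W.Point) : P.xRep = ![P.xRep 0, P.xRep 1] := by
      ext i; fin_cases i <;> rfl
    have := hC₂ (hvec P ▸ P.xRep_ne_zero) (hvec Q ▸ Q.xRep_ne_zero)
    rwa [← hvec, ← hvec] at this
  refine ⟨C₁ + 3 * C₂, fun P Q ↦ ?_⟩
  obtain ⟨t, ht⟩ := exists_eval_addSubMap P Q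
  have ht0 : t ≠ 0 := by
    rintro rfl
    rw [zero_smul] at ht
    exact addSubMap_ne_zero W (sym2x_ne_zero P Q) ht
  have h1 := hC₁ (P.sym2x Q)
  rw [ht, logHeight_smul_eq_logHeight _ ht0] at h1
  have h2 := hsym P Q
  have h3 := hsym (P + Q) (P - Q)
  rw [abs_le] at *
  constructor <;> linarith

omit [DecidableEq F] in
lemma finite_xRep_mem {s : Set (Fin 2 → F)} (hs : s.Finite) :
    {P : W.Point | P.xRep ∈ s}.Finite := by
  refine hs.preimage' fun v _ ↦ ?_
  by_cases hv : ∃ P : W.Point, P.xRep = v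
  · obtain ⟨P, rfl⟩ := hv
    exact (Set.toFinite {P, -P}).subset fun Q hQ ↦ eq_or_eq_neg_of_xRep_eq_xRep hQ
  · convert! Set.finite_empty
    ext P
    simpa using fun h ↦ hv ⟨P, h⟩

open Height in
instance northcott_naiveHeight [AdmissibleAbsValues F] [Northcott (logHeight₁ (K := F))] :
    Northcott (naiveHeight (W := W)) where
  finite_le B := by
    have hfin : (insert ![1, 0] ((fun x : F ↦ ![x, 1]) '' {x | logHeight₁ x ≤ B})).Finite :=
      ((Northcott.finite_le B).image _).insert _
    refine (finite_xRep_mem hfin).subset fun P hP ↦ ?_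
    match P with
    | 0 => exact .inl rfl
    | some x y h =>
      refine .inr ⟨x, ?_, rfl⟩
      rw [Set.mem_ofPred_eq, logHeight₁_eq_logHeight]
      exact hP

open Height in
lemma fg_of_finiteIndex_two [AdmissibleAbsValues F] [Northcott (logHeight₁ (K := F))]
    [W.IsElliptic] (h : (nsmulAddMonoidHom (α := W.Point) 2).range.FiniteIndex) :
    AddGroup.FG W.Point := by
  obtain ⟨C, hC⟩ := abs_naiveHeight_le (W := W)
  exact AddCommGroup.fg_of_descent' (h := naiveHeight) h (fun P ↦ logHeight_nonneg _) hC

end Point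

omit [DecidableEq F] in
lemma four_mul_eval_addPolynomial (x y ℓ e : F)
    (he : 4 * e ^ 3 + W.b₂ * e ^ 2 + 2 * W.b₄ * e + W.b₆ = 0) :
    4 * (W.addPolynomial x y ℓ).eval e =
      (2 * (ℓ * (e - x) + y) + W.a₁ * e + W.a₃) ^ 2 := by
  rw [addPolynomial_eq]
  simp only [b₂, b₄, b₆] at he
  simp [Cubic.toPoly]
  linear_combination -he

/-- If `P + Q` is affine and `(x(P) - e) (x(Q) - e)` is a nonzero square, then so is
`x(P + Q) - e`, for every root `e` of the two-torsion polynomial. -/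
lemma isSquare_addX_sub {x₁ y₁ x₂ y₂ e : F} (h2 : (2 : F) ≠ 0) (h₁ : W.Equation x₁ y₁)
    (h₂ : W.Equation x₂ y₂) (hxy : ¬(x₁ = x₂ ∧ y₁ = W.negY x₂ y₂))
    (he : 4 * e ^ 3 + W.b₂ * e ^ 2 + 2 * W.b₄ * e + W.b₆ = 0)
    (h₁e : x₁ ≠ e) (h₂e : x₂ ≠ e) (hsq : IsSquare ((x₁ - e) * (x₂ - e))) :
    IsSquare (W.addX x₁ x₂ (W.slope x₁ x₂ y₁ y₂) - e) := by
  have h := four_mul_eval_addPolynomial x₁ y₁ (W.slope x₁ x₂ y₁ y₂) e he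
  rw [addPolynomial_slope h₁ h₂ hxy] at h
  simp only [Polynomial.eval_neg, Polynomial.eval_mul, Polynomial.eval_sub, Polynomial.eval_X,
    Polynomial.eval_C] at h
  obtain ⟨r, hr⟩ := hsq
  have hr0 : r ≠ 0 := by
    rintro rfl
    rw [mul_zero, mul_eq_zero, sub_eq_zero, sub_eq_zero] at hr
    exact hr.elim h₁e h₂e
  generalize W.addX x₁ x₂ (W.slope x₁ x₂ y₁ y₂) = X at *
  generalize 2 * (W.slope x₁ x₂ y₁ y₂ * (e - x₁) + y₁) + W.a₁ * e + W.a₃ = z at *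
  refine ⟨z / (2 * r), ?_⟩
  field_simp
  linear_combination h - 4 * (X - e) * hr

/-- A point with `x - eᵢ` a square for every root `eᵢ` of the two-torsion polynomial is divisible
by two. -/
lemma mem_range_two_of_isSquare [W.IsElliptic] (h2 : (2 : F) ≠ 0) {e₁ e₂ e₃ x y : F}
    (h₂ : W.b₂ = -4 * (e₁ + e₂ + e₃)) (h₄ : W.b₄ = 2 * (e₁ * e₂ + e₁ * e₃ + e₂ * e₃))
    (h₆ : W.b₆ = -4 * (e₁ * e₂ * e₃)) (h12 : e₁ ≠ e₂) (h13 : e₁ ≠ e₃) (h23 : e₂ ≠ e₃)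
    (h : W.Nonsingular x y)
    (hs₁ : IsSquare (x - e₁)) (hs₂ : IsSquare (x - e₂)) (hs₃ : IsSquare (x - e₃)) :
    ∃ P : W.Point, Point.some x y h = P + P := by
  obtain ⟨r₁, hr₁⟩ := hs₁
  obtain ⟨r₂, hr₂⟩ := hs₂
  obtain ⟨r₃, hr₃⟩ := hs₃
  have h4 : (4 : F) ≠ 0 := by
    rw [show (4 : F) = 2 * 2 by norm_num]
    exact mul_ne_zero h2 h2
  have h₈ : W.b₈ = -4 * (e₁ + e₂ + e₃) * -(e₁ * e₂ * e₃) -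
      (e₁ * e₂ + e₁ * e₃ + e₂ * e₃) ^ 2 := by
    refine mul_left_cancel₀ h4 ?_
    rw [b_relation, h₂, h₄, h₆]
    ring
  have hr12 : r₁ + r₂ ≠ 0 := fun h ↦ h12 (by linear_combination hr₂ - hr₁ + (r₂ - r₁) * h)
  have hr13 : r₁ + r₃ ≠ 0 := fun h ↦ h13 (by linear_combination hr₃ - hr₁ + (r₃ - r₁) * h)
  have hr23 : r₂ + r₃ ≠ 0 := fun h ↦ h23 (by linear_combination hr₃ - hr₂ + (r₃ - r₂) * h)
  set X := x + r₁ * r₂ + r₁ * r₃ + r₂ * r₃ with hX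
  set η := (r₁ + r₂) * (r₁ + r₃) * (r₂ + r₃) with hη
  have hη0 : η ≠ 0 := mul_ne_zero (mul_ne_zero hr12 hr13) hr23
  set Y := (2 * η - W.a₁ * X - W.a₃) / 2 with hY
  have hYη : 2 * Y + W.a₁ * X + W.a₃ = 2 * η := by
    rw [hY]
    field_simp
    ring
  have hXe : η ^ 2 = (X - e₁) * (X - e₂) * (X - e₃) := by
    have h1 : X - e₁ = (r₁ + r₂) * (r₁ + r₃) := by linear_combination hr₁
    have h2 : X - e₂ = (r₁ + r₂) * (r₂ + r₃) := by linear_combination hr₂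
    have h3 : X - e₃ = (r₁ + r₃) * (r₂ + r₃) := by linear_combination hr₃
    rw [h1, h2, h3, hη]
    ring
  have hΨ : 4 * X ^ 3 + W.b₂ * X ^ 2 + 2 * W.b₄ * X + W.b₆ = 4 * η ^ 2 := by
    rw [hXe, h₂, h₄, h₆]
    ring
  have hEq : W.Equation X Y := by
    rw [equation_iff]
    refine mul_left_cancel₀ h4 ?_
    have hΨ' := hΨ
    simp only [b₂, b₄, b₆] at hΨ'
    linear_combination (2 * Y + W.a₁ * X + W.a₃ + 2 * η) * hYη - hΨ'
  have hns : W.Nonsingular X Y := (equation_iff_nonsingular).1 hEq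
  have hYne : Y ≠ W.negY X Y := by
    rw [← sub_ne_zero, show Y - W.negY X Y = 2 * η by rw [← hYη, negY]; ring]
    exact mul_ne_zero h2 hη0
  have hdup := addX_self_mul hEq hYne
  have hxX : x = W.addX X X (W.slope X X Y Y) := by
    rw [hΨ] at hdup
    refine mul_right_cancel₀ (mul_ne_zero h4 (pow_ne_zero 2 hη0)) (Eq.trans ?_ hdup.symm)
    rw [h₄, h₆, h₈]
    have e1 : e₁ = x - r₁ * r₁ := by rw [← hr₁]; ring
    have e2 : e₂ = x - r₂ * r₂ := by rw [← hr₂]; ring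
    have e3 : e₃ = x - r₃ * r₃ := by rw [← hr₃]; ring
    rw [hη, hX, e1, e2, e3]
    ring
  rcases Point.X_eq_iff (h₁ := h) (h₂ := nonsingular_add hns hns fun h ↦ hYne h.2) |>.1 hxX
    with hP | hP
  · exact ⟨.some X Y hns, by rw [hP, Point.add_self_of_Y_ne hYne]⟩
  · exact ⟨-.some X Y hns, by rw [hP, ← neg_add, Point.add_self_of_Y_ne hYne]⟩

end WeierstrassCurve.Affine

section SquareClasses

open UniqueFactorizationMonoid

variable {R : Type*} [CommRing R] [IsDedekindDomain R]

lemma Ideal.exists_eq_squarefree_mul_sq (I : Ideal R) (hI : I ≠ ⊥) :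
    ∃ J A : Ideal R, Squarefree J ∧ I = J * A ^ 2 := by
  induction I using induction_on_prime with
  | h₁ => exact absurd rfl hI
  | h₂ I hu => exact ⟨I, 1, hu.squarefree, by rw [one_pow, mul_one]⟩
  | h₃ I p hI0 hp ih =>
    obtain ⟨J, A, hJ, rfl⟩ := ih hI0
    by_cases hpJ : p ∣ J
    · obtain ⟨J', rfl⟩ := hpJ
      exact ⟨J', p * A, hJ.of_mul_right, by ring⟩
    · refine ⟨p * J, A, ?_, by ring⟩
      rw [squarefree_mul_iff]
      exact ⟨(hp.irreducible.isRelPrime_iff_not_dvd).2 hpJ, hp.irreducible.squarefree, hJ⟩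

/-- If `v(a)` is a square in the value group, then `v` does not divide the squarefree part of
`a`. -/
lemma IsDedekindDomain.HeightOneSpectrum.not_dvd_of_isSquare_intValuation
    (v : HeightOneSpectrum R) {a : R} (ha : a ≠ 0) (hv : IsSquare (v.intValuation a))
    {J A : Ideal R} (hJ : Squarefree J) (h : Ideal.span {a} = J * A ^ 2) : ¬ v.asIdeal ∣ J := by
  intro hdvd
  have hne : J * A ^ 2 ≠ ⊥ := by
    rw [← h]
    simpa using ha
  have hfin : FiniteMultiplicity v.asIdeal (J * A ^ 2) := .of_prime_left v.prime hne
  have hfinA : FiniteMultiplicity v.asIdeal (A * A) := by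
    rw [← sq]
    exact hfin.mul_right
  have hJ1 : multiplicity v.asIdeal J = 1 := by
    obtain ⟨J', rfl⟩ := hdvd
    have hJ' : ¬ v.asIdeal ∣ J' := fun ⟨J'', h''⟩ ↦ v.prime.not_isUnit
      (hJ v.asIdeal ⟨J'', by rw [h'', mul_assoc]⟩)
    rw [multiplicity_mul v.prime hfin.mul_left, multiplicity_eq_zero.2 hJ',
      multiplicity_self]
  have hm : multiplicity v.asIdeal (Ideal.span {a}) = 1 + 2 * multiplicity v.asIdeal A := by
    rw [h, multiplicity_mul v.prime hfin, hJ1, sq, multiplicity_mul v.prime hfinA]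
    ring
  obtain ⟨γ, hγ⟩ := hv
  rw [v.intValuation_eq_exp_neg_multiplicity ha] at hγ
  have hγ0 : γ ≠ 0 := by
    rintro rfl
    simp at hγ
  rw [← WithZero.exp_log hγ0, ← WithZero.exp_add, WithZero.exp_inj, hm] at hγ
  push_cast at hγ
  omega

lemma Ideal.finite_squarefree_of_finite {S : Set (HeightOneSpectrum R)} (hS : S.Finite) :
    {J : Ideal R | Squarefree J ∧ ∀ v : HeightOneSpectrum R, v.asIdeal ∣ J → v ∈ S}.Finite := by
  classical
  refine ((hS.image HeightOneSpectrum.asIdeal).toFinset.powerset.image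
    fun s ↦ ∏ p ∈ s, p).finite_toSet.subset ?_
  rintro J ⟨hJ, hJS⟩
  have hnd := (squarefree_iff_nodup_normalizedFactors hJ.ne_zero).1 hJ
  simp only [Finset.coe_image, Set.mem_image, Finset.mem_coe, Finset.mem_powerset]
  refine ⟨(normalizedFactors J).toFinset, fun p hp ↦ ?_, ?_⟩
  · rw [Multiset.mem_toFinset] at hp
    have hp' := prime_of_normalized_factor p hp
    rw [Set.Finite.mem_toFinset]
    exact ⟨⟨p, Ideal.isPrime_of_prime hp', hp'.ne_zero⟩,
      hJS _ (dvd_of_mem_normalizedFactors hp), rfl⟩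
  · rw [Finset.prod_eq_multiset_prod, Multiset.toFinset_val, hnd.dedup, Multiset.map_id',
      Ideal.prod_normalizedFactors_eq_self hJ.ne_zero]

variable {K : Type*} [Field K] [Algebra R K] [IsFractionRing R K]

lemma IsDedekindDomain.HeightOneSpectrum.finite_valuation_ne_one {x : K} (hx : x ≠ 0) :
    {v : HeightOneSpectrum R | v.valuation K x ≠ 1}.Finite := by
  refine ((HeightOneSpectrum.Support.finite R x).union
    (HeightOneSpectrum.Support.finite R x⁻¹)).subset fun v hv ↦ ?_
  rcases lt_or_gt_of_ne hv with h | h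
  · refine .inr ?_
    change 1 < v.valuation K x⁻¹
    rw [map_inv₀]
    exact (one_lt_inv₀ ((v.valuation K).pos_iff.2 hx)).2 h
  · exact .inl h

end SquareClasses

lemma NumberField.finite_units_quotient_sq (K : Type*) [Field K] [NumberField K] :
    Finite ((𝓞 K)ˣ ⧸ (powMonoidHom (α := (𝓞 K)ˣ) 2).range) := by
  have : Group.FG (𝓞 K)ˣ := Group.fg_iff_monoid_fg.2 inferInstance
  refine CommGroup.finite_of_fg_isMulTorsion _ fun u ↦ ?_
  induction u using QuotientGroup.induction_on with | H u =>
  refine isOfFinOrder_iff_pow_eq_one.2 ⟨2, two_pos, ?_⟩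
  exact (QuotientGroup.eq_one_iff _).2 ⟨u, rfl⟩

open nonZeroDivisors in
/-- The Selmer group `K(S, 2)` is finite. -/
theorem NumberField.exists_finite_isSquare_mul {K : Type*} [Field K] [NumberField K]
    {S : Set (HeightOneSpectrum (𝓞 K))} (hS : S.Finite) :
    ∃ T : Set K, T.Finite ∧ ∀ x : K, x ≠ 0 → (∀ v ∉ S, IsSquare (v.valuation K x)) →
      ∃ t ∈ T, t ≠ 0 ∧ IsSquare (x * t) := by
  classical
  have := finite_units_quotient_sq K
  set 𝒥 := {J : Ideal (𝓞 K) | Squarefree J ∧ ∀ v : HeightOneSpectrum (𝓞 K), v.asIdeal ∣ J → v ∈ S}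
  have : Finite 𝒥 := Ideal.finite_squarefree_of_finite hS
  let P (J : 𝒥) (c : ClassGroup (𝓞 K)) (a : 𝓞 K) : Prop :=
    a ≠ 0 ∧ ∃ A : (Ideal (𝓞 K))⁰, ClassGroup.mk0 A = c ∧ Ideal.span {a} = J * (A : Ideal (𝓞 K)) ^ 2
  let rep (J : 𝒥) (c : ClassGroup (𝓞 K)) : 𝓞 K := if h : ∃ a, P J c a then h.choose else 1
  let f : (𝒥 × ClassGroup (𝓞 K)) × ((𝓞 K)ˣ ⧸ (powMonoidHom (α := (𝓞 K)ˣ) 2).range) → K :=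
    fun p ↦ algebraMap (𝓞 K) K ((p.2.out : (𝓞 K)ˣ) * rep p.1.1 p.1.2)
  refine ⟨Set.range f, Set.finite_range f, fun x hx hxS ↦ ?_⟩
  obtain ⟨n, d, hd, rfl⟩ := IsFractionRing.div_surjective (A := 𝓞 K) x
  have hd0 : d ≠ 0 := nonZeroDivisors.ne_zero hd
  have hdK : algebraMap (𝓞 K) K d ≠ 0 := by simpa using hd0
  have hnK : algebraMap (𝓞 K) K n ≠ 0 := fun h ↦ hx (by rw [h, zero_div])
  set a := n * d with ha
  have ha0 : a ≠ 0 := mul_ne_zero (fun h ↦ hnK (by rw [h, map_zero])) hd0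
  have hax : algebraMap (𝓞 K) K a =
      algebraMap (𝓞 K) K n / algebraMap (𝓞 K) K d * algebraMap (𝓞 K) K d ^ 2 := by
    rw [ha, map_mul]
    field_simp
  obtain ⟨J, A, hJ, haJ⟩ := (Ideal.span {a}).exists_eq_squarefree_mul_sq (by simpa using ha0)
  have hJ𝒥 : J ∈ 𝒥 := by
    refine ⟨hJ, fun v hv ↦ ?_⟩
    by_contra hvS
    refine v.not_dvd_of_isSquare_intValuation ha0 ?_ hJ haJ hv
    rw [← show v.valuation K (algebraMap (𝓞 K) K a) = _ from v.valuation_of_algebraMap a, hax,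
      map_mul,
      map_pow]
    exact (hxS v hvS).mul (IsSquare.sq _)
  have hA0 : A ≠ ⊥ := by
    rintro rfl
    refine ha0 ?_
    simpa [Ideal.bot_pow] using haJ
  set A' : (Ideal (𝓞 K))⁰ := ⟨A, mem_nonZeroDivisors_of_ne_zero hA0⟩
  have hP : ∃ a, P ⟨J, hJ𝒥⟩ (ClassGroup.mk0 A') a := ⟨a, ha0, A', rfl, haJ⟩
  set a₀ := rep ⟨J, hJ𝒥⟩ (ClassGroup.mk0 A') with ha₀
  have ha₀P : P ⟨J, hJ𝒥⟩ (ClassGroup.mk0 A') a₀ := by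
    rw [ha₀, show rep _ _ = _ from dif_pos hP]
    exact hP.choose_spec
  obtain ⟨ha₀0, B, hB, ha₀B⟩ := ha₀P
  obtain ⟨y, z, hy, hz, hyz⟩ := ClassGroup.mk0_eq_mk0_iff.1 hB.symm
  have hass : Associated (z ^ 2 * a₀) (y ^ 2 * a) := by
    rw [← Ideal.span_singleton_eq_span_singleton]
    rw [← Ideal.span_singleton_mul_span_singleton, ← Ideal.span_singleton_mul_span_singleton,
      ← Ideal.span_singleton_pow, ← Ideal.span_singleton_pow, haJ, ha₀B]
    calc Ideal.span {z} ^ 2 * (J * (B : Ideal (𝓞 K)) ^ 2)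
        = J * (Ideal.span {z} * B) ^ 2 := by ring
      _ = J * (Ideal.span {y} * A) ^ 2 := by rw [← hyz]
      _ = _ := by ring
  obtain ⟨w, hw⟩ := hass
  set q : (𝓞 K)ˣ ⧸ (powMonoidHom (α := (𝓞 K)ˣ) 2).range := QuotientGroup.mk w
  obtain ⟨s, hs⟩ : ∃ s : (𝓞 K)ˣ, q.out * s ^ 2 = w := by
    obtain ⟨s, hs⟩ := QuotientGroup.eq.1 (QuotientGroup.out_eq' q)
    exact ⟨s, by rw [show s ^ 2 = _ from hs, mul_inv_cancel_left]⟩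
  refine ⟨_, ⟨((⟨J, hJ𝒥⟩, ClassGroup.mk0 A'), q), rfl⟩, ?_, ?_⟩
  · simpa [f] using ha₀0
  · have hyK : algebraMap (𝓞 K) K y ≠ 0 := by simpa using hy
    have hw' := congrArg (algebraMap (𝓞 K) K) hw
    rw [← hs, map_mul, map_mul, map_mul, hax, map_pow, map_pow] at hw'
    simp only [f, map_mul, ← ha₀]
    simp only [Units.val_mul, Units.val_pow_eq_pow_val, map_mul, map_pow] at hw'
    generalize algebraMap (𝓞 K) K n / algebraMap (𝓞 K) K d = x at *
    refine ⟨algebraMap (𝓞 K) K z * algebraMap (𝓞 K) K a₀ * algebraMap (𝓞 K) K (q.out : (𝓞 K)ˣ) *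
      algebraMap (𝓞 K) K s / (algebraMap (𝓞 K) K d * algebraMap (𝓞 K) K y), ?_⟩
    rw [div_mul_div_comm, eq_div_iff (mul_ne_zero (mul_ne_zero hdK hyK) (mul_ne_zero hdK hyK))]
    linear_combination -(algebraMap (𝓞 K) K a₀ * algebraMap (𝓞 K) K (q.out : (𝓞 K)ˣ)) * hw'

lemma Valuation.isSquare_of_sq_eq_mul {K Γ₀ : Type*} [Field K] [LinearOrderedCommGroupWithZero Γ₀]
    (v : Valuation K Γ₀) {a b c y : K} (h : y ^ 2 = a * b * c) (hab : v (a - b) = 1)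
    (hac : v (a - c) = 1) : IsSquare (v a) := by
  have hy : v y * v y = v a * v b * v c := by
    rw [← map_mul, ← map_mul, ← map_mul, ← sq, h]
  rcases lt_trichotomy (v a) 1 with ha | ha | ha
  · have hb : v b = 1 := by
      rw [← v.map_neg, show -b = (a - b) - a by ring, v.map_sub_eq_of_lt_left (hab ▸ ha), hab]
    have hc : v c = 1 := by
      rw [← v.map_neg, show -c = (a - c) - a by ring, v.map_sub_eq_of_lt_left (hac ▸ ha), hac]
    exact ⟨v y, by rw [hy, hb, hc, mul_one, mul_one]⟩
  · exact ha ▸ IsSquare.one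
  · have hb : v b = v a := by
      rw [show b = a - (a - b) by ring, v.map_sub_eq_of_lt_left (hab ▸ ha)]
    have hc : v c = v a := by
      rw [show c = a - (a - c) by ring, v.map_sub_eq_of_lt_left (hac ▸ ha)]
    have ha0 : v a ≠ 0 := (zero_lt_one.trans ha).ne'
    refine ⟨v y / v a, ?_⟩
    rw [div_mul_div_comm, hy, hb, hc, mul_assoc, mul_div_assoc, div_self (mul_ne_zero ha0 ha0),
      mul_one]

namespace WeierstrassCurve.Affine

section

variable {F : Type*} [Field F] [DecidableEq F] {W : Affine F} [W.IsElliptic]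

/-- Two points at which each `x - eᵢ` takes values in the same nonzero square class agree modulo
`2 E`. -/
lemma add_mem_range_two (h2 : (2 : F) ≠ 0) {e : Fin 3 → F}
    (h₂ : W.b₂ = -4 * (e 0 + e 1 + e 2)) (h₄ : W.b₄ = 2 * (e 0 * e 1 + e 0 * e 2 + e 1 * e 2))
    (h₆ : W.b₆ = -4 * (e 0 * e 1 * e 2)) (he : Function.Injective e) {x y x' y' : F}
    (h : W.Nonsingular x y) (h' : W.Nonsingular x' y') (hx : ∀ i, x ≠ e i) (hx' : ∀ i, x' ≠ e i)
    (hs : ∀ i, IsSquare ((x - e i) * (x' - e i))) :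
    ∃ P : W.Point, Point.some x y h + Point.some x' y' h' = P + P := by
  by_cases hxy : x = x' ∧ y = W.negY x' y'
  · exact ⟨0, by rw [Point.add_of_Y_eq hxy.1 hxy.2, add_zero]⟩
  · rw [Point.add_some hxy]
    have hroot (i : Fin 3) : 4 * e i ^ 3 + W.b₂ * e i ^ 2 + 2 * W.b₄ * e i + W.b₆ = 0 := by
      rw [h₂, h₄, h₆]
      fin_cases i <;> simp <;> ring
    have hsq (i : Fin 3) := isSquare_addX_sub h2 h.1 h'.1 hxy (hroot i) (hx i) (hx' i) (hs i)
    exact mem_range_two_of_isSquare h2 h₂ h₄ h₆ (he.ne (by decide)) (he.ne (by decide))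
      (he.ne (by decide)) _ (hsq 0) (hsq 1) (hsq 2)

end

variable {K : Type*} [Field K] [NumberField K] [DecidableEq K] {W : Affine K} [W.IsElliptic]

/-- The weak Mordell-Weil theorem for curves with full rational two-torsion. -/
theorem finiteIndex_two_of_two_torsion {e : Fin 3 → K}
    (h₂ : W.b₂ = -4 * (e 0 + e 1 + e 2)) (h₄ : W.b₄ = 2 * (e 0 * e 1 + e 0 * e 2 + e 1 * e 2))
    (h₆ : W.b₆ = -4 * (e 0 * e 1 * e 2)) (he : Function.Injective e) :
    (nsmulAddMonoidHom (α := W.Point) 2).range.FiniteIndex := by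
  have h2 : (2 : K) ≠ 0 := two_ne_zero
  set S : Set (HeightOneSpectrum (𝓞 K)) :=
    ⋃ p : {p : Fin 3 × Fin 3 // p.1 ≠ p.2}, {v | v.valuation K (e p.1.1 - e p.1.2) ≠ 1}
  have hS : S.Finite := Set.finite_iUnion fun p ↦
    HeightOneSpectrum.finite_valuation_ne_one (sub_ne_zero.2 (he.ne p.2))
  have hval {v : HeightOneSpectrum (𝓞 K)} (hv : v ∉ S) {i j : Fin 3} (hij : i ≠ j) :
      v.valuation K (e i - e j) = 1 := by
    by_contra h
    exact hv (Set.mem_iUnion.2 ⟨⟨(i, j), hij⟩, h⟩)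
  have hsq {x y : K} (h : W.Nonsingular x y) {v : HeightOneSpectrum (𝓞 K)} (hv : v ∉ S)
      (i : Fin 3) : IsSquare (v.valuation K (x - e i)) := by
    have hη := sq_sub_negY h.1
    rw [h₂, h₄, h₆] at hη
    have hη' : ((y - W.negY x y) / 2) ^ 2 = (x - e 0) * (x - e 1) * (x - e 2) := by
      rw [div_pow, hη]
      ring
    fin_cases i
    · refine (v.valuation K).isSquare_of_sq_eq_mul hη' ?_ ?_
      · simpa using hval hv (i := 1) (j := 0) (by decide)
      · simpa using hval hv (i := 2) (j := 0) (by decide)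
    · refine (v.valuation K).isSquare_of_sq_eq_mul (hη'.trans (b := _)
        (c := (x - e 1) * (x - e 0) * (x - e 2)) (by ring)) ?_ ?_
      · simpa using hval hv (i := 0) (j := 1) (by decide)
      · simpa using hval hv (i := 2) (j := 1) (by decide)
    · refine (v.valuation K).isSquare_of_sq_eq_mul (hη'.trans (b := _)
        (c := (x - e 2) * (x - e 0) * (x - e 1)) (by ring)) ?_ ?_
      · simpa using hval hv (i := 0) (j := 2) (by decide)
      · simpa using hval hv (i := 1) (j := 2) (by decide)
  obtain ⟨T, hT, hTS⟩ := NumberField.exists_finite_isSquare_mul hS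
  have hfin : (insert ![1, 0] (Set.range fun i : Fin 3 ↦ ![e i, 1])).Finite :=
    (Set.finite_range _).insert _
  let mk : W.Point → W.Point ⧸ (nsmulAddMonoidHom (α := W.Point) 2).range := QuotientAddGroup.mk
  let C (t : Fin 3 → K) : Set W.Point := {P | ∃ x y h, P = .some x y h ∧ (∀ i, x ≠ e i) ∧
    ∀ i, t i ≠ 0 ∧ IsSquare ((x - e i) * t i)}
  have hC (t : Fin 3 → K) : (mk '' C t).Finite := by
    refine Set.Subsingleton.finite ?_
    rintro _ ⟨_, ⟨x, y, h, rfl, hx, ht⟩, rfl⟩ _ ⟨_, ⟨x', y', h', rfl, hx', ht'⟩, rfl⟩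
    obtain ⟨P, hP⟩ := add_mem_range_two h2 h₂ h₄ h₆ he h h' hx hx' fun i ↦ by
      obtain ⟨ht0, r, hr⟩ := ht i
      obtain ⟨-, r', hr'⟩ := ht' i
      refine ⟨r * r' / t i, ?_⟩
      field_simp
      linear_combination (x' - e i) * t i * hr + r * r * hr'
    refine QuotientAddGroup.eq.2 ⟨P - .some x y h, ?_⟩
    change 2 • (P - .some x y h) = _
    rw [smul_sub, two_nsmul, ← hP, two_nsmul]
    abel
  have : Finite (W.Point ⧸ (nsmulAddMonoidHom (α := W.Point) 2).range) := by
    refine Set.finite_univ_iff.1 ((((Point.finite_xRep_mem hfin).image mk).union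
      ((Set.Finite.pi' fun _ : Fin 3 ↦ hT).biUnion fun t _ ↦ hC t)).subset fun q _ ↦ ?_)
    obtain ⟨P, rfl⟩ := QuotientAddGroup.mk_surjective q
    match P with
    | 0 => exact .inl ⟨0, .inl rfl, rfl⟩
    | .some x y h =>
      by_cases hx : ∃ i, x = e i
      · obtain ⟨i, rfl⟩ := hx
        exact .inl ⟨_, .inr ⟨i, rfl⟩, rfl⟩
      · simp only [not_exists] at hx
        choose t htT ht using fun i ↦ hTS (x - e i) (sub_ne_zero.2 (hx i)) fun v hv ↦ hsq h hv i
        exact .inr (Set.mem_biUnion (x := t) htT ⟨_, ⟨x, y, h, rfl, hx, ht⟩, rfl⟩)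
  exact AddSubgroup.finiteIndex_of_finite_quotient

end WeierstrassCurve.Affine

/-- The Mordell-Weil theorem for curves with full rational two-torsion. -/
theorem WeierstrassCurve.fg_point_of_splits {K L : Type*} [Field K] [NumberField K] [Field L]
    [NumberField L] [DecidableEq L] (f : K →+* L) (W : WeierstrassCurve K) [W.IsElliptic]
    (hf : (W.twoTorsionPolynomial.toPoly.map f).Splits) :
    AddGroup.FG (W.map f).toAffine.Point := by
  have ha : W.twoTorsionPolynomial.a ≠ 0 := show (4 : K) ≠ 0 by norm_num
  obtain ⟨x, y, z, h3⟩ := (Cubic.splits_iff_roots_eq_three ha).1 hf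
  obtain ⟨hxy, hxz, hyz⟩ := (Cubic.discr_ne_zero_iff_roots_ne ha h3).1
    (W.twoTorsionPolynomial_discr_ne_zero (isUnit_iff_ne_zero.2 two_ne_zero) W.isUnit_Δ)
  have hb : f W.b₂ = f 4 * -(x + y + z) := Cubic.b_eq_three_roots ha h3
  have hc : f (2 * W.b₄) = f 4 * (x * y + x * z + y * z) := Cubic.c_eq_three_roots ha h3
  have hd : f W.b₆ = f 4 * -(x * y * z) := Cubic.d_eq_three_roots ha h3
  rw [map_ofNat] at hb hc hd
  rw [map_mul, map_ofNat] at hc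
  refine Affine.Point.fg_of_finiteIndex_two
    (Affine.finiteIndex_two_of_two_torsion (e := ![x, y, z]) ?_ ?_ ?_ ?_)
  · rw [map_b₂, hb]
    simp
    ring
  · refine mul_left_cancel₀ (two_ne_zero (α := L)) ?_
    rw [map_b₄, hc]
    simp
    ring
  · rw [map_b₆, hd]
    simp
  · intro i j hij
    fin_cases i <;> fin_cases j <;> simp_all [eq_comm]

lemma AddGroup.FG.of_injective {A B : Type*} [AddCommGroup A] [AddCommGroup B] (hB : AddGroup.FG B)
    (f : A →+ B) (hf : Function.Injective f) : AddGroup.FG A := by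
  have := Module.Finite.iff_addGroup_fg.2 hB
  exact Module.Finite.iff_addGroup_fg.1 (Module.Finite.of_injective f.toIntLinearMap hf)

/-- The **Mordell-Weil theorem**. -/
theorem WeierstrassCurve.fg_pts {F : Type*} [Field F] (W : WeierstrassCurve F) [W.IsElliptic]
    (K : Type*) [Field K] [NumberField K] [Algebra F K] : AddGroup.FG (Pts W K) := by
  classical
  have : (W.baseChange K).IsElliptic := inferInstanceAs (W.map (algebraMap F K)).IsElliptic
  let L := (W.baseChange K).twoTorsionPolynomial.toPoly.SplittingField
  have : CharZero L := charZero_of_injective_algebraMap (algebraMap K L).injective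
  have : FiniteDimensional ℚ L := FiniteDimensional.trans ℚ K L
  have : NumberField L := {}
  have hfg := (W.baseChange K).fg_point_of_splits (algebraMap K L)
    (Polynomial.SplittingField.splits _)
  have hmap : (W.baseChange K).map (algebraMap K L) = W.baseChange L := by
    change (W.map (algebraMap F K)).map (algebraMap K L) = W.map (algebraMap F L)
    rw [WeierstrassCurve.map_map, ← IsScalarTower.algebraMap_eq]
  rw [hmap] at hfg
  have hfg' : AddGroup.FG (Pts W L) := by
    convert! hfg
  exact hfg'.of_injective (Pts.map W (IsScalarTower.toAlgHom F K L)) (Pts.map_injective W _)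

/-- The cohomology of a finite group is killed by the order of the group. -/
lemma H1.card_nsmul_eq_zero {Γ M : Type*} [Group Γ] [Finite Γ] [TopologicalSpace Γ] [AddCommGroup M]
    [DistribMulAction Γ M] (x : H1 Γ M) : Nat.card Γ • x = 0 := by
  have := Fintype.ofFinite Γ
  induction x using QuotientAddGroup.induction_on with | H f =>
  refine (QuotientAddGroup.eq_zero_iff _).2 ⟨-∑ h, f.1 h, fun g ↦ ?_⟩
  have h1 : ∑ h, f.1 h = g • ∑ h, f.1 h + Nat.card Γ • f.1 g := by
    conv_lhs => rw [← Equiv.sum_comp (Equiv.mulLeft g)]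
    rw [Finset.smul_sum, Nat.card_eq_fintype_card,
      ← Finset.card_univ, ← Finset.sum_const, ← Finset.sum_add_distrib]
    exact Finset.sum_congr rfl fun h _ ↦ f.2.2 g h
  change g • (-∑ h, f.1 h) - -∑ h, f.1 h = Nat.card Γ • f.1 g
  rw [smul_neg, sub_neg_eq_add]
  nth_rw 2 [h1]
  abel

/-- `H¹` of a finite group with finitely generated coefficients is finite. -/
theorem H1.finite_of_fg {Γ M : Type*} [Group Γ] [Finite Γ] [TopologicalSpace Γ] [AddCommGroup M]
    [DistribMulAction Γ M] (hM : AddGroup.FG M) : Finite (H1 Γ M) := by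
  have := Module.Finite.iff_addGroup_fg.2 hM
  have hfg : AddGroup.FG (contCocycles₁ Γ M) :=
    (Module.Finite.iff_addGroup_fg.1 (inferInstance : Module.Finite ℤ (Γ → M))).of_injective
      (contCocycles₁ Γ M).subtype Subtype.val_injective
  have : AddGroup.FG (H1 Γ M) := QuotientAddGroup.fg _
  exact AddCommGroup.finite_of_fg_isAddTorsion _ fun x ↦
    isOfFinAddOrder_iff_nsmul_eq_zero.2 ⟨_, Nat.card_pos, x.card_nsmul_eq_zero⟩

lemma Pts.map_id {R S L : Type*} [CommRing R] [CommRing S] [Field L] [Algebra R S] [Algebra R L]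
    [Algebra S L] [IsScalarTower R S L] (W : WeierstrassCurve R) (P : Pts W L) :
    Pts.map W (AlgHom.id S L) P = P := by
  match P with
  | .zero => rfl
  | .some _ _ _ => rfl

/-- An embedding of an algebraic extension into a field containing an algebraically closed field
`A` takes its values in `A`. -/
lemma AlgHom.exists_comp_eq_of_isAlgClosed {F Ω A B : Type*} [Field F] [Field Ω] [Field A] [Field B]
    [Algebra F Ω] [Algebra F A] [Algebra F B] [IsAlgClosed A] [Algebra.IsAlgebraic F Ω]
    (j : A →ₐ[F] B) (ι : Ω →ₐ[F] B) : ∃ ι' : Ω →ₐ[F] A, ∀ x, j (ι' x) = ι x := by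
  have h (x : Ω) : ι x ∈ j.range := by
    algebraize [j.toRingHom]
    have : IsScalarTower F A B := .of_algebraMap_eq fun x ↦ (j.commutes x).symm
    have hx : IsIntegral A (ι x) :=
      ((Algebra.IsAlgebraic.isAlgebraic (R := F) x).isIntegral.map ι).tower_top
    exact minpoly.mem_range_of_degree_eq_one A _
      (IsAlgClosed.degree_eq_one_of_irreducible A (minpoly.irreducible hx))
  let e := AlgEquiv.ofInjective j j.injective
  refine ⟨e.symm.toAlgHom.comp (ι.codRestrict j.range h), fun x ↦ ?_⟩
  exact congrArg Subtype.val (e.apply_symm_apply ⟨ι x, h x⟩)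

/-- If a class dies in the cohomology of `Gal(A/M)`, its restriction to `Gal(Ω/L)` dies in the
cohomology of `Gal(B/N)`, for compatible embeddings of `Ω` and `A` into `B`. -/
lemma galMap_galMap_eq_zero {F L M N Ω A B : Type*} [Field F] [Field L] [Field M] [Field N]
    [Field Ω] [Field A] [Field B] [Algebra F L] [Algebra F M] [Algebra F N] [Algebra F Ω]
    [Algebra F A] [Algebra F B] [Algebra L Ω] [Algebra L B] [Algebra M A] [Algebra M N]
    [Algebra M B] [Algebra N B] [IsScalarTower F L Ω] [IsScalarTower F L B] [IsScalarTower F M A]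
    [IsScalarTower F M B] [IsScalarTower F N B] [IsScalarTower M N B]
    [Normal F Ω] [Normal L Ω] [Normal M A] [Algebra L N] [IsScalarTower L N B]
    (W : WeierstrassCurve F) (ι' : Ω →ₐ[F] A) (j : A →ₐ[M] B) (ι : Ω →ₐ[L] B)
    (h : ∀ x, j (ι' x) = ι x) {x : H1 (Ω ≃ₐ[F] Ω) (Pts W Ω)} (hx : galMap (L := M) W ι' x = 0) :
    galMap (L := N) W ι (galMap (L := L) W (AlgHom.id F Ω) x) = 0 := by
  induction x using QuotientAddGroup.induction_on with | H f =>
  obtain ⟨m, hm⟩ := (QuotientAddGroup.eq_zero_iff _).1 hx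
  refine (QuotientAddGroup.eq_zero_iff _).2 ⟨Pts.map W j m, fun τ ↦ ?_⟩
  have hres : galRes (L := M) ι' (galRes j τ) =
      galRes (L := L) (AlgHom.id F Ω) (galRes (L := N) ι τ) := by
    ext y
    refine ι.injective (show ι _ = ι _ from ?_)
    rw [← h, galRes_apply, galRes_apply, h]
    exact ((galRes_apply ι τ y).symm.trans (congrArg ι
      (galRes_apply (AlgHom.id F Ω) (galRes (L := N) ι τ) y).symm))
  have hm' := congrArg (Pts.map W j) (hm (galRes j τ))
  rw [map_sub, Pts.map_galRes_smul] at hm'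
  refine hm'.trans ?_
  change Pts.map W j (Pts.map W ι' (f.1 _)) = Pts.map W ι (Pts.map W (AlgHom.id F Ω) (f.1 _))
  rw [hres, Pts.map_id]
  generalize f.1 _ = P
  match P with
  | .zero => rfl
  | .some x y _ =>
    change WeierstrassCurve.Affine.Point.some (j (ι' x)) (j (ι' y)) _ = .some (ι x) (ι y) _
    simp only [h]

lemma Place.exists_liesOver {F K : Type*} [Field F] [NumberField F] [Field K] [NumberField K]
    [Algebra F K] : (w : Place K) → ∃ v : Place F, w.LiesOver v
  | .inl w => ⟨.inl (w.under (𝓞 F)), ⟨w.asIdeal.over_under (A := 𝓞 F)⟩⟩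
  | .inr w => ⟨.inr (w.comap (algebraMap F K)), ⟨⟨rfl⟩⟩⟩

section Restriction

variable {F K Ω : Type*} [Field F] [Field K] [Algebra F K] [IsGalois F K] [Field Ω] [Algebra F Ω]
  [Algebra K Ω] [IsScalarTower F K Ω] [IsGalois F Ω] [Normal K Ω] (W : WeierstrassCurve F)

/-- The transgression vanishes on restrictions. -/
theorem transMap_resMap (x : H1 (Ω ≃ₐ[F] Ω) (Pts W Ω)) :
    transMap W K Ω (resMap W K Ω x) = 0 := by
  refine (transMap_spec W K Ω _).unique W ?_
  induction x using QuotientAddGroup.induction_on with | H f =>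
  refine ⟨_, 0, rfl, rfl, f.1, fun n ↦ (Pts.map_id W _).symm, fun a b ↦ ?_⟩
  rw [f.2.2 a b]
  simp

variable [NumberField F] [NumberField K]

/-- Restriction maps `Ш(E/F)` into `Ш(E/K)`. -/
theorem shaRes_mem_shaInv (x : Sha W F Ω) : shaRes W K Ω x ∈ shaInv W K Ω := by
  obtain ⟨x, hx⟩ := x
  change galMap (L := K) W (AlgHom.id F Ω) x ∈ Sha W K Ω
  simp only [Sha, AddSubgroup.mem_iInf] at hx ⊢
  intro v ι
  obtain ⟨u, huv⟩ := v.exists_liesOver (F := F)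
  let j : AlgebraicClosure u.Completion →ₐ[u.Completion] AlgebraicClosure v.Completion :=
    IsAlgClosed.lift
  obtain ⟨ι', hι'⟩ := AlgHom.exists_comp_eq_of_isAlgClosed (j.restrictScalars F)
    (ι.restrictScalars F)
  exact galMap_galMap_eq_zero W ι' j ι hι' (hx u ι')

theorem shaRes_range_le : (shaRes W K Ω).range ≤ shaInv W K Ω := by
  rintro _ ⟨x, rfl⟩
  exact shaRes_mem_shaInv W x

theorem range_addSubgroupOf_le_ker :
    (shaRes W K Ω).range.addSubgroupOf (shaInv W K Ω) ≤ (shaTrans W K Ω).ker := by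
  rintro ⟨_, _⟩ ⟨x, rfl⟩
  exact transMap_resMap W x.1

end Restriction

lemma AddMonoidHom.card_eq_card_range_mul_card_ker {G H : Type*} [AddGroup G] [AddGroup H]
    (f : G →+ H) : Nat.card G = Nat.card f.range * Nat.card f.ker := by
  rw [AddSubgroup.card_eq_card_quotient_mul_card_addSubgroup f.ker,
    Nat.card_congr (QuotientAddGroup.quotientKerEquivRange f).toEquiv]

/-- Counting in an exact sequence `0 → A → B → C → D → 0`. -/
lemma card_mul_card_of_exact {A B C D : Type*} [AddGroup A] [AddGroup B] [AddGroup C] [AddGroup D]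
    (α : A →+ B) (β : B →+ C) (γ : C →+ D) (hα : Function.Injective α)
    (hαβ : Function.Exact α β) (hβγ : Function.Exact β γ) (hγ : Function.Surjective γ) :
    Nat.card A * Nat.card C = Nat.card B * Nat.card D := by
  have h1 : Nat.card A = Nat.card β.ker := by
    rw [hαβ.addMonoidHom_ker_eq]
    exact Nat.card_congr (AddMonoidHom.ofInjective hα).toEquiv
  have h2 : Nat.card β.range = Nat.card γ.ker := by rw [hβγ.addMonoidHom_ker_eq]
  have h4 : Nat.card γ.range = Nat.card D := by
    rw [AddMonoidHom.range_eq_top.2 hγ]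
    exact Nat.card_congr AddSubgroup.topEquiv.toEquiv
  rw [β.card_eq_card_range_mul_card_ker, γ.card_eq_card_range_mul_card_ker, h4, ← h1, ← h2]
  ring

lemma finite_of_exact {B C D : Type*} [AddGroup B] [AddGroup C] [AddGroup D]
    [Finite B] [Finite D] (β : B →+ C) (γ : C →+ D) (hβγ : Function.Exact β γ) :
    Finite C := by
  have : Finite γ.ker := by
    rw [hβγ.addMonoidHom_ker_eq]
    exact Finite.of_surjective _ β.rangeRestrict_surjective
  have : Finite (C ⧸ γ.ker) := Finite.of_injective _ (QuotientAddGroup.kerLift_injective γ)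
  exact Finite.of_addSubgroup_quotient γ.ker

section DirectSum

open scoped DirectSum

variable {ι : Type*} {M : ι → Type*} [∀ i, AddCommGroup (M i)]

lemma DirectSum.finite_of_finite [Finite (⨁ i, M i)] (i : ι) : Finite (M i) := by
  classical
  exact Finite.of_injective _ (DirectSum.of_injective (β := M) i)

lemma DirectSum.finite_nontrivial [Finite (⨁ i, M i)] : {i | Nontrivial (M i)}.Finite := by
  classical
  choose x hx using fun i : {i // Nontrivial (M i)} ↦
    haveI := i.2
    exists_ne (0 : M i)
  refine Set.finite_coe_iff.1 (Finite.of_injective (β := ⨁ i, M i)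
    (fun i : {i // Nontrivial (M i)} ↦ DirectSum.of M i (x i)) fun i j hij ↦ ?_)
  by_contra hne
  have h := congrArg (fun y : ⨁ i, M i ↦ y i) hij
  simp only [DirectSum.of_eq_same] at h
  rw [DirectSum.of_eq_of_ne _ _ _ fun h ↦ hne (Subtype.ext h)] at h
  exact hx i h

lemma DirectSum.card_eq_finprod [Finite (⨁ i, M i)] :
    Nat.card (⨁ i, M i) = ∏ᶠ i, Nat.card (M i) := by
  classical
  set S := (DirectSum.finite_nontrivial (M := M)).toFinset
  have hS {i : ι} (hi : i ∉ S) : Subsingleton (M i) := by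
    simpa [S, not_nontrivial_iff_subsingleton] using hi
  have hcard : Nat.card (⨁ i, M i) = Nat.card (∀ i : S, M i) := by
    refine Nat.card_congr (Equiv.ofBijective (fun x (i : S) ↦ x (i : ι))
      ⟨fun x y hxy ↦ ?_, fun y ↦ ?_⟩)
    · refine DFinsupp.ext fun i ↦ ?_
      by_cases hi : i ∈ S
      · exact congrFun hxy ⟨i, hi⟩
      · have := hS hi
        exact Subsingleton.elim _ _
    · refine ⟨DirectSum.mk M S y, funext fun i ↦ ?_⟩
      exact DirectSum.mk_apply_of_mem i.2
  rw [hcard, Nat.card_pi, finprod_eq_prod_of_mulSupport_subset (s := S)]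
  · exact Finset.prod_coe_sort S fun i ↦ Nat.card (M i)
  · intro i hi
    by_contra hiS
    have := hS hiS
    exact hi Nat.card_unique

end DirectSum

set_option synthInstance.maxHeartbeats 200000 in
theorem mainTheorem8
    {F K Ω : Type*} [Field F] [NumberField F] [Field K] [NumberField K] [Algebra F K]
    [IsGalois F K] [Field Ω] [Algebra F Ω] [Algebra K Ω] [IsScalarTower F K Ω]
    [IsAlgClosure F Ω] [IsAlgClosure K Ω]
    (W : WeierstrassCurve F) [W.IsElliptic]
    (hF : Finite (Sha W F Ω)) (hK : Finite (Sha W K Ω))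
    (w : Place F → Place K) [∀ v, (w v).LiesOver v]
    (hexact : SequenceExact W Ω w) :
    (Finite (H1 (K ≃ₐ[F] K) (Pts W K)) ∧
      (∀ v, Finite (LocalH1 W (w v) v)) ∧ {v | Nontrivial (LocalH1 W (w v) v)}.Finite) ∧
    (Nat.card (shaTrans W K Ω).ker : ℚ) / Nat.card (Sha W F Ω) =
      (∏ᶠ v : Place F, (Nat.card (LocalH1 W (w v) v) : ℚ)) /
        Nat.card (H1 (K ≃ₐ[F] K) (Pts W K)) ∧
    (shaTrans W K Ω = 0 ↔
      (Nat.card (shaInv W K Ω) : ℚ) / Nat.card (Sha W F Ω) =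
        (∏ᶠ v : Place F, (Nat.card (LocalH1 W (w v) v) : ℚ)) /
          Nat.card (H1 (K ≃ₐ[F] K) (Pts W K))) := by
  have hH : Finite (H1 (K ≃ₐ[F] K) (Pts W K)) :=
    have : FiniteDimensional F K := Module.Finite.of_restrictScalars_finite ℚ F K
    H1.finite_of_fg (W.fg_pts K)
  have hInv : Finite (shaInv W K Ω) :=
    Finite.of_injective (fun x ↦ (⟨x.1.1, x.2⟩ : Sha W K Ω)) fun x y h ↦
      Subtype.ext (Subtype.ext (Subtype.mk.inj h))
  obtain ⟨α, β, γ, -, hα, hαβ, hβγ, hγ⟩ := hexact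
  have hsum : Finite (DirectSum (Place F) fun v ↦ LocalH1 W (w v) v) :=
    finite_of_exact β γ hβγ
  have hcount := card_mul_card_of_exact α β γ hα hαβ hβγ hγ
  rw [DirectSum.card_eq_finprod] at hcount
  have hprod : (∏ᶠ v : Place F, (Nat.card (LocalH1 W (w v) v) : ℚ)) =
      ((∏ᶠ v : Place F, Nat.card (LocalH1 W (w v) v) : ℕ) : ℚ) := by
    refine ((Nat.castRingHom ℚ : ℕ →* ℚ).map_finprod ((DirectSum.finite_nontrivial
      (M := fun v ↦ LocalH1 W (w v) v)).subset fun v hv ↦ ?_)).symm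
    by_contra hvn
    have := not_nontrivial_iff_subsingleton.1 hvn
    exact hv Nat.card_unique
  have hSha := (shaRes W K Ω).card_eq_card_range_mul_card_ker
  have hker : Nat.card (shaTrans W K Ω).ker =
      Nat.card (TransQuotient W K Ω) * Nat.card (shaRes W K Ω).range := by
    rw [AddSubgroup.card_eq_card_quotient_mul_card_addSubgroup
      (((shaRes W K Ω).range.addSubgroupOf (shaInv W K Ω)).addSubgroupOf (shaTrans W K Ω).ker)]
    congr 1
    exact Nat.card_congr ((AddSubgroup.addSubgroupOfEquivOfLe (range_addSubgroupOf_le_ker W)).trans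
      (AddSubgroup.addSubgroupOfEquivOfLe (shaRes_range_le W))).toEquiv
  have hShaF0 : (Nat.card (Sha W F Ω) : ℚ) ≠ 0 := Nat.cast_ne_zero.2 Nat.card_pos.ne'
  have hmain : (Nat.card (shaTrans W K Ω).ker : ℚ) / Nat.card (Sha W F Ω) =
      (∏ᶠ v : Place F, (Nat.card (LocalH1 W (w v) v) : ℚ)) /
        Nat.card (H1 (K ≃ₐ[F] K) (Pts W K)) := by
    rw [div_eq_div_iff hShaF0 (Nat.cast_ne_zero.2 Nat.card_pos.ne'), hprod]
    norm_cast
    rw [hker, hSha]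
    rw [mul_right_comm, mul_comm (Nat.card (TransQuotient W K Ω)), ← hcount]
    ring
  refine ⟨⟨hH, DirectSum.finite_of_finite (M := fun v ↦ LocalH1 W (w v) v),
    DirectSum.finite_nontrivial (M := fun v ↦ LocalH1 W (w v) v)⟩, hmain, ?_⟩
  rw [← hmain, div_left_inj' hShaF0, Nat.cast_inj]
  refine ⟨fun h ↦ ?_, fun h ↦ ?_⟩
  · rw [h, AddMonoidHom.ker_zero]
    exact (Nat.card_congr AddSubgroup.topEquiv.toEquiv).symm
  · exact (AddMonoidHom.ker_eq_top_iff).1 (AddSubgroup.eq_top_of_card_eq _ h.symm)
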